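/- Write $[p,q]$ for the closed straight segment with end points $p,q\in\mathbb{R}^2$, and $S_r(a,b)$ for the circle $\{(x,y):(x-a)^2+(y-b)^2=r^2\}$. The 26 uppercase letters of the sans-serif font of TeX, drawn with zero thickness (baseline $y=0$, cap height $20$), are modelled as the following subsets of $\mathbb{R}^2$. - A: $[(0,0),(8,20)]\cup[(8,20),(16,0)]\cup[(2,5),(14,5)]$. - B: $[(0,0),(0,20)]\cup[(0,20),(8,20)]\cup[(0,10),(8,10)]\cup[(0,0),(8,0)]\cup(S_5(8,15)\cap\{x\ge 8\})\cup(S_5(8,5)\cap\{x\ge 8\})$. - C: $S_{10}(10,10)\cap\{x\le 16\}$. - D: $[(0,0),(0,20)]\cup[(0,20),(6,20)]\cup[(0,0),(6,0)]\cup(S_{10}(6,10)\cap\{x\ge 6\})$. - E: $[(0,0),(0,20)]\cup[(0,20),(12,20)]\cup[(0,10),(11,10)]\cup[(0,0),(12,0)]$. - F: $[(0,0),(0,20)]\cup[(0,20),(12,20)]\cup[(0,10),(11,10)]$. - G: $(S_{10}(10,10)\cap\{x\le 16\})\cup[(16,0),(16,8)]\cup[(11,8),(16,8)]$. - H: $[(0,0),(0,20)]\cup[(14,0),(14,20)]\cup[(0,10),(14,10)]$.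 - I: $[(0,0),(0,20)]$. - J: $[(10,5),(10,20)]\cup(S_5(5,5)\cap\{y\le 5\})$. - K: $[(0,0),(0,20)]\cup[(0,7),(13,20)]\cup[(4,11),(15,0)]$. - L: $[(0,0),(0,20)]\cup[(0,0),(11,0)]$. - M: $[(0,0),(0,20)]\cup[(0,20),(9,0)]\cup[(9,0),(18,20)]\cup[(18,20),(18,0)]$. - N: $[(0,0),(0,20)]\cup[(0,20),(14,0)]\cup[(14,0),(14,20)]$. - O: $S_{10}(10,10)$. - P: $[(0,0),(0,20)]\cup[(0,20),(7,20)]\cup[(0,10),(7,10)]\cup(S_5(7,15)\cap\{x\ge 7\})$. - Q: $S_{10}(10,10)\cup[(13,6),(19,-2)]$. - R: the set P together with $[(6,10),(12,0)]$. - S: $(S_5(6,15)\cap\{x\le 6\text{ or }y\ge 18\})\cup(S_5(6,5)\cap\{x\ge 6\text{ or }y\le 2\})$. - T: $[(0,20),(16,20)]\cup[(8,0),(8,20)]$. - U: $[(0,7),(0,20)]\cup[(14,7),(14,20)]\cup(S_7(7,7)\cap\{y\le 7\})$. - V: $[(0,20),(8,0)]\cup[(8,0),(16,20)]$. - W: $[(0,20),(6,0)]\cup[(6,0),(12,20)]\cup[(12,20),(18,0)]\cup[(18,0),(24,20)]$.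 - X: $[(0,0),(16,20)]\cup[(0,20),(16,0)]$. - Y: $[(0,20),(8,8)]\cup[(16,20),(8,8)]\cup[(8,0),(8,8)]$. - Z: $[(0,20),(13,20)]\cup[(13,20),(0,0)]\cup[(0,0),(13,0)]$. For $X\subset\mathbb{R}^2$ and $p\in X$, the *intersection order* of $p$ in $X$ is the number of path components of $X\setminus\{p\}$. For $n\in\mathbb{N}$ let $N(n,X)\in\mathbb{N}\cup\{\infty\}$ be the number of points $p\in X$ whose intersection order in $X$ is $n$. Then the following hold. 1. With respect to homeomorphism (for the subspace topologies), the 26 letters fall into exactly nine classes: $\{A,R\}$, $\{B\}$, $\{C,I,J,L,M,N,S,U,V,W,Z\}$, $\{D,O\}$, $\{E,F,G,T,Y\}$, $\{H,K\}$, $\{P\}$, $\{Q\}$, $\{X\}$. 2. Two letters $X,Y$ satisfy $N(n,X)=N(n,Y)$ for all $n\in\mathbb{N}$ if and only if they are homeomorphic, or both belong to $\{A,R,P\}$, or both belong to $\{B,D,O\}$. 3. There are two distinct points $p,q$ of B such that $q$ has intersection order $3$ in $B\setminus\{p\}$, whereas for all distinct points $p,q$ of O the point $q$ has intersection order $2$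 in $O\setminus\{p\}$. 4. There are two distinct points $p,z$ of A such that $p$ has intersection order $2$ in A and $z$ has intersection order $4$ in $A\setminus\{p\}$, whereas for every point $p$ of P of intersection order $2$ in P and every point $z\neq p$ of P, the intersection order of $z$ in $P\setminus\{p\}$ is $2$ or $3$. -/

import Mathlib

namespace Alphabet

/-- The plane `ℝ²`. Only its topology is used, and the product topology is the Euclidean one. -/
abbrev Plane : Type := ℝ × ℝ

/-- The closed straight segment with end points `(a, b)` and `(c, d)`. -/
def seg (a b c d : ℝ) : Set Plane := segment ℝ ((a, b) : Plane) ((c, d) : Plane)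

/-- The circle with centre `(a, b)` and radius `r`. -/
def circ (a b r : ℝ) : Set Plane := {p | (p.1 - a) ^ 2 + (p.2 - b) ^ 2 = r ^ 2}

/-- The twenty-six uppercase letters, as names. -/
inductive Letter : Type
  | A | B | C | D | E | F | G | H | I | J | K | L | M
  | N | O | P | Q | R | S | T | U | V | W | X | Y | Z

/-- The uppercase letters in the sans serif font of TeX, drawn with zero thickness: each letter is
the union of its strokes, which are straight segments and circular arcs. The baseline is the line
`y = 0`, and the cap height is `20`. -/
def Letter.shape : Letter → Set Plane
  -- two legs and the crossbar
  | .A => seg 0 0 8 20 ∪ seg 8 20 16 0 ∪ seg 2 5 14 5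
  -- stem, three bars, upper and lower bowl
  | .B => seg 0 0 0 20 ∪ seg 0 20 8 20 ∪ seg 0 10 8 10 ∪ seg 0 0 8 0 ∪
      (circ 8 15 5 ∩ {p | 8 ≤ p.1}) ∪ (circ 8 5 5 ∩ {p | 8 ≤ p.1})
  -- an arc open to the right, from `(16, 18)` round to `(16, 2)`
  | .C => circ 10 10 10 ∩ {p | p.1 ≤ 16}
  -- stem, two bars, bowl
  | .D => seg 0 0 0 20 ∪ seg 0 20 6 20 ∪ seg 0 0 6 0 ∪ (circ 6 10 10 ∩ {p | 6 ≤ p.1})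
  -- stem and three arms
  | .E => seg 0 0 0 20 ∪ seg 0 20 12 20 ∪ seg 0 10 11 10 ∪ seg 0 0 12 0
  -- stem and two arms
  | .F => seg 0 0 0 20 ∪ seg 0 20 12 20 ∪ seg 0 10 11 10
  -- the arc of C, which ends at `(16, 2)` on a short vertical stem, and the bar on top of that stem
  | .G => (circ 10 10 10 ∩ {p | p.1 ≤ 16}) ∪ seg 16 0 16 8 ∪ seg 11 8 16 8
  -- two stems and the bar
  | .H => seg 0 0 0 20 ∪ seg 14 0 14 20 ∪ seg 0 10 14 10
  -- the stem
  | .I => seg 0 0 0 20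
  -- stem and hook
  | .J => seg 10 5 10 20 ∪ (circ 5 5 5 ∩ {p | p.2 ≤ 5})
  -- stem, a diagonal that starts on the stem, and a leg that starts on the diagonal at `(4, 11)`
  | .K => seg 0 0 0 20 ∪ seg 0 7 13 20 ∪ seg 4 11 15 0
  -- stem and foot
  | .L => seg 0 0 0 20 ∪ seg 0 0 11 0
  -- two stems and two diagonals
  | .M => seg 0 0 0 20 ∪ seg 0 20 9 0 ∪ seg 9 0 18 20 ∪ seg 18 20 18 0
  -- two stems and the diagonal
  | .N => seg 0 0 0 20 ∪ seg 0 20 14 0 ∪ seg 14 0 14 20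
  -- a circle
  | .O => circ 10 10 10
  -- stem, two bars, bowl
  | .P => seg 0 0 0 20 ∪ seg 0 20 7 20 ∪ seg 0 10 7 10 ∪ (circ 7 15 5 ∩ {p | 7 ≤ p.1})
  -- a circle and the tail, which crosses it at `(16, 2)`
  | .Q => circ 10 10 10 ∪ seg 13 6 19 (-2)
  -- the letter P and a leg that starts on the lower bar at `(6, 10)`
  | .R => seg 0 0 0 20 ∪ seg 0 20 7 20 ∪ seg 0 10 7 10 ∪ (circ 7 15 5 ∩ {p | 7 ≤ p.1}) ∪
      seg 6 10 12 0
  -- upper arc from `(10, 18)` by the top and the left to `(6, 10)`, and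
  -- lower arc from `(6, 10)` by the right and the bottom to `(2, 2)`
  | .S => (circ 6 15 5 ∩ {p | p.1 ≤ 6 ∨ 18 ≤ p.2}) ∪ (circ 6 5 5 ∩ {p | 6 ≤ p.1 ∨ p.2 ≤ 2})
  -- top bar and stem
  | .T => seg 0 20 16 20 ∪ seg 8 0 8 20
  -- two stems joined by a lower half circle
  | .U => seg 0 7 0 20 ∪ seg 14 7 14 20 ∪ (circ 7 7 7 ∩ {p | p.2 ≤ 7})
  -- two diagonals
  | .V => seg 0 20 8 0 ∪ seg 8 0 16 20
  -- four diagonals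
  | .W => seg 0 20 6 0 ∪ seg 6 0 12 20 ∪ seg 12 20 18 0 ∪ seg 18 0 24 20
  -- two diagonals that cross at `(8, 10)`
  | .X => seg 0 0 16 20 ∪ seg 0 20 16 0
  -- two arms that meet the stem at `(8, 8)`
  | .Y => seg 0 20 8 8 ∪ seg 16 20 8 8 ∪ seg 8 0 8 8
  -- top bar, diagonal, foot
  | .Z => seg 0 20 13 20 ∪ seg 13 20 0 0 ∪ seg 0 0 13 0

/-- Two subsets of the plane are homeomorphic (with their subspace topologies). -/
def Homeomorphic (X Y : Set Plane) : Prop := Nonempty (X ≃ₜ Y)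

/-- The relation "the two letters are homeomorphic" on the alphabet. -/
def homeomorphismSetoid : Setoid Letter where
  r a b := Homeomorphic a.shape b.shape
  iseqv :=
    { refl := fun _ => ⟨Homeomorph.refl _⟩
      symm := fun ⟨h⟩ => ⟨h.symm⟩
      trans := fun ⟨h⟩ ⟨k⟩ => ⟨h.trans k⟩ }

/-- The number of path components of a subset of the plane (`⊤` if there are infinitely many). -/
noncomputable def numPathComponents (X : Set Plane) : ℕ∞ := ENat.card (ZerothHomotopy X)

/-- The intersection order of `p` in `X`: the number of path components of `X - {p}`. -/
noncomputable def intersectionOrder (X : Set Plane) (p : Plane) : ℕ∞ :=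
  numPathComponents (X \ {p})

/-- `orderCount n X` is the number (possibly `⊤`) of points of `X` with intersection order `n`. -/
noncomputable def orderCount (n : ℕ) (X : Set Plane) : ℕ∞ :=
  {p : Plane | p ∈ X ∧ intersectionOrder X p = n}.encard

end Alphabet

namespace Alphabet
open Set Topology

/-! A letter is a finite multigraph drawn in the plane: simple arcs and closed curves that meet only
at vertices. Such a set is a continuous image of finitely many copies of `[0, 1]`, and by
compactness a quotient of them. The identification is read off the graph alone, so letters with the
same multigraph are homeomorphic (`Realizes.homeomorphic`). Nine multigraphs occur.

To tell them apart, delete vertices: the path components that remain correspond to the classes of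
edges linked through the other vertices (`Realizes.numPathComponents_diff`). A point inside an edge
becomes a vertex after a subdivision (`Realizes.subdiv`). Hence every intersection order, also after
the removal of a first point, is a component count of a finite graph, which `decide` computes. The
interior points of one edge share one order, so the number of points of order `n` is infinite if `n`
is the order of an edge and is otherwise a count of vertices (`Realizes.orderCount_eq`).

These counts are topological invariants and separate the nine types up to two coincidences: a cycle
with one or with two tails, and a circle or a theta curve. Removing two points settles both. Without
its two branch points a theta curve has three pieces, while a circle without two points always has
two; a cycle with two tails falls into four pieces, while one tail allows at most three if the first
point has order 2.

What remains is to cut each letter at its branch points and to check by arithmetic that the pieces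
meet as its graph prescribes. -/

/-! ### ### Simple arcs and closed curves: concatenation and splitting -/

/-- `γ` restricted to `[0, 1]` is a parametrization of `S` from `a` to `b`, injective except that
`a = b` is allowed: `S` is a simple arc, or a simple closed curve with base point `a = b`. -/
structure EdgeParam (γ : ℝ → Plane) (S : Set Plane) (a b : Plane) : Prop where
  cont : ContinuousOn γ (Icc 0 1)
  zero : γ 0 = a
  one : γ 1 = b
  image : γ '' Icc 0 1 = S
  inj : ∀ s ∈ Icc (0 : ℝ) 1, ∀ t ∈ Ioo (0 : ℝ) 1, γ s = γ t → s = t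

/-- `S` is a simple arc from `a` to `b`, or a simple closed curve with base point `a = b`. -/
def IsEdge (S : Set Plane) (a b : Plane) : Prop := ∃ γ, EdgeParam γ S a b

theorem IsEdge.of_Icc {γ : ℝ → Plane} {S : Set Plane} {a b : Plane} {c d : ℝ} (hcd : c < d)
    (cont : ContinuousOn γ (Icc c d)) (hc : γ c = a) (hd : γ d = b) (image : γ '' Icc c d = S)
    (inj : ∀ s ∈ Icc c d, ∀ t ∈ Ioo c d, γ s = γ t → s = t) : IsEdge S a b := by
  have hpos : 0 < d - c := sub_pos.2 hcd
  have hmap : ∀ t ∈ Icc (0 : ℝ) 1, c + t * (d - c) ∈ Icc c d := fun t ht =>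
    ⟨by nlinarith [ht.1], by nlinarith [ht.2]⟩
  refine ⟨fun t => γ (c + t * (d - c)), ?_, by simpa using hc, by simpa using hd, ?_, ?_⟩
  · exact cont.comp (by fun_prop) hmap
  · rw [← image]
    ext p
    constructor
    · rintro ⟨t, ht, rfl⟩
      exact ⟨_, hmap t ht, rfl⟩
    · rintro ⟨t, ht, rfl⟩
      refine ⟨(t - c) / (d - c), ⟨div_nonneg (sub_nonneg.2 ht.1) hpos.le,
        (div_le_one hpos).2 (by linarith [ht.2])⟩, ?_⟩
      simp only
      congr 1
      field_simp
      ring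
  · intro s hs t ht h
    have := inj _ (hmap s hs) _ ⟨by nlinarith [ht.1], by nlinarith [ht.2]⟩ h
    have h2 : (s - t) * (d - c) = 0 := by linarith
    rcases mul_eq_zero.1 h2 with h3 | h3 <;> linarith

theorem IsEdge.left_mem {S : Set Plane} {a b : Plane} (h : IsEdge S a b) : a ∈ S := by
  obtain ⟨γ, h⟩ := h
  rw [← h.image, ← h.zero]
  exact mem_image_of_mem _ (by simp)

theorem IsEdge.right_mem {S : Set Plane} {a b : Plane} (h : IsEdge S a b) : b ∈ S := by
  obtain ⟨γ, h⟩ := h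
  rw [← h.image, ← h.one]
  exact mem_image_of_mem _ (by simp)

theorem IsEdge.symm {S : Set Plane} {a b : Plane} (h : IsEdge S a b) : IsEdge S b a := by
  obtain ⟨γ, h⟩ := h
  have hmap : ∀ t ∈ Icc (0 : ℝ) 1, 1 - t ∈ Icc (0 : ℝ) 1 := fun t ht =>
    ⟨by linarith [ht.2], by linarith [ht.1]⟩
  refine ⟨fun t => γ (1 - t), h.cont.comp (by fun_prop) hmap, by simpa using h.one,
    by simpa using h.zero, ?_, ?_⟩
  · rw [← h.image]
    ext p
    constructor
    · rintro ⟨t, ht, rfl⟩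
      exact ⟨_, hmap t ht, rfl⟩
    · rintro ⟨t, ht, rfl⟩
      exact ⟨_, hmap t ht, by simp⟩
  · intro s hs t ht hst
    have := h.inj _ (hmap s hs) _ ⟨by linarith [ht.2], by linarith [ht.1]⟩ hst
    linarith

/-- The alternative `p = a ∧ p = c` can occur only if `a = c`. It lets the concatenation close up,
so that one lemma builds both arcs and closed curves; `hab` and `hbc` say that neither piece is
closed already. -/
theorem IsEdge.trans {S T : Set Plane} {a b c : Plane} (h₁ : IsEdge S a b) (h₂ : IsEdge T b c)
    (hab : a ≠ b) (hbc : b ≠ c) (h : ∀ p ∈ S, p ∈ T → p = b ∨ p = a ∧ p = c) :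
    IsEdge (S ∪ T) a c := by
  obtain ⟨γ, h₁⟩ := h₁
  obtain ⟨δ, h₂⟩ := h₂
  set η : ℝ → Plane := fun t => if t ≤ 1 then γ t else δ (t - 1) with hη
  have η₁ : ∀ t ≤ (1 : ℝ), η t = γ t := fun t ht => by simp [hη, ht]
  have η₂ : ∀ t, (1 : ℝ) ≤ t → η t = δ (t - 1) := fun t ht => by
    rcases ht.eq_or_lt with rfl | ht
    · simp [hη, h₁.one, h₂.zero]
    · simp [hη, not_le.2 ht]
  have hshift : ∀ t ∈ Icc (1 : ℝ) 2, t - 1 ∈ Icc (0 : ℝ) 1 := fun t ht =>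
    ⟨by linarith [ht.1], by linarith [ht.2]⟩
  have hIcc : Icc (0 : ℝ) 2 = Icc 0 1 ∪ Icc 1 2 := (Icc_union_Icc_eq_Icc (by simp) (by simp)).symm
  -- The pieces meet only at the junction or, if the curve closes up, at the two outer ends.
  have key : ∀ s ∈ Icc (0 : ℝ) 1, ∀ t ∈ Icc (0 : ℝ) 1, γ s = δ t →
      s = 1 ∧ t = 0 ∨ s = 0 ∧ t = 1 := by
    intro s hs t ht hst
    have hS : γ s ∈ S := h₁.image ▸ mem_image_of_mem _ hs
    have hT : γ s ∈ T := hst ▸ h₂.image ▸ mem_image_of_mem _ ht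
    have hs' : γ s = b → s = 1 := by
      intro hb
      by_contra hne
      rcases hs.1.eq_or_lt with rfl | h0
      · exact hab (h₁.zero ▸ hb)
      · exact hne (h₁.inj 1 (by simp) s ⟨h0, lt_of_le_of_ne hs.2 hne⟩ (by rw [h₁.one, hb])).symm
    have ht' : δ t = b → t = 0 := by
      intro hb
      by_contra hne
      rcases ht.2.eq_or_lt with rfl | h0
      · exact hbc (h₂.one ▸ hb).symm
      · exact hne (h₂.inj 0 (by simp) t ⟨lt_of_le_of_ne ht.1 (Ne.symm hne), h0⟩
          (by rw [h₂.zero, hb])).symm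
    rcases h _ hS hT with hb | ⟨ha, hc⟩
    · exact Or.inl ⟨hs' hb, ht' (hst ▸ hb)⟩
    · right
      constructor
      · by_contra hne
        rcases hs.2.eq_or_lt with rfl | h0
        · exact hab (h₁.one ▸ ha).symm
        · exact hne (h₁.inj 0 (by simp) s ⟨lt_of_le_of_ne hs.1 (Ne.symm hne), h0⟩
            (by rw [h₁.zero, ha])).symm
      · by_contra hne
        rcases ht.1.eq_or_lt with rfl | h0
        · exact hbc (by rw [← h₂.zero, ← hst, hc])
        · exact hne (h₂.inj 1 (by simp) t ⟨h0, lt_of_le_of_ne ht.2 hne⟩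
            (by rw [h₂.one, ← hst, hc])).symm
  refine IsEdge.of_Icc (γ := η) (c := 0) (d := 2) (by norm_num) ?_ ?_ ?_ ?_ ?_
  · rw [hIcc]
    refine ContinuousOn.union_of_isClosed ?_ ?_ isClosed_Icc isClosed_Icc
    · exact h₁.cont.congr fun t ht => η₁ t ht.2
    · exact (h₂.cont.comp (f := fun t : ℝ => t - 1) (by fun_prop) hshift).congr
        fun t ht => η₂ t ht.1
  · rw [η₁ 0 (by norm_num), h₁.zero]
  · rw [η₂ 2 (by norm_num)]
    norm_num [h₂.one]
  · rw [hIcc, image_union, ← h₁.image, ← h₂.image]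
    congr 1
    · exact image_congr fun t ht => η₁ t ht.2
    · ext p
      constructor
      · rintro ⟨t, ht, rfl⟩
        exact ⟨_, hshift t ht, (η₂ t ht.1).symm⟩
      · rintro ⟨t, ht, rfl⟩
        exact ⟨t + 1, ⟨by linarith [ht.1], by linarith [ht.2]⟩, by
          rw [η₂ _ (by linarith [ht.1])]; simp⟩
  · intro s hs t ht hst
    rcases le_or_gt s 1 with hs1 | hs1 <;> rcases le_or_gt t 1 with ht1 | ht1
    · rw [η₁ s hs1, η₁ t ht1] at hst
      rcases ht1.eq_or_lt with rfl | ht1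
      · rcases hs1.eq_or_lt with rfl | hs1
        · rfl
        rcases hs.1.eq_or_lt with rfl | hs0
        · exact absurd (by rw [← h₁.zero, hst, h₁.one]) hab
        · exact (h₁.inj 1 (by simp) s ⟨hs0, hs1⟩ hst.symm).symm
      · exact h₁.inj s ⟨hs.1, hs1⟩ t ⟨ht.1, ht1⟩ hst
    · rw [η₁ s hs1, η₂ t ht1.le] at hst
      rcases key s ⟨hs.1, hs1⟩ _ (hshift t ⟨ht1.le, ht.2.le⟩) hst with h3 | h3 <;>
        linarith [ht.2]
    · rw [η₂ s hs1.le, η₁ t ht1] at hst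
      rcases key t ⟨ht.1.le, ht1⟩ _ (hshift s ⟨hs1.le, hs.2⟩) hst.symm with h3 | h3 <;>
        linarith [ht.1]
    · rw [η₂ s hs1.le, η₂ t ht1.le] at hst
      have := h₂.inj _ (hshift s ⟨hs1.le, hs.2⟩) _ ⟨by linarith, by linarith [ht.2]⟩ hst
      linarith

theorem IsEdge.exists_split {S : Set Plane} {a b p : Plane} (h : IsEdge S a b) (hp : p ∈ S)
    (hpa : p ≠ a) (hpb : p ≠ b) :
    ∃ S₁ S₂, IsEdge S₁ a p ∧ IsEdge S₂ p b ∧ S₁ ∪ S₂ = S ∧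
      ∀ x ∈ S₁, x ∈ S₂ → x = p ∨ x = a ∧ x = b := by
  obtain ⟨γ, h⟩ := h
  rw [← h.image] at hp
  obtain ⟨t, ht, rfl⟩ := hp
  have h0 : 0 < t := lt_of_le_of_ne ht.1 (by rintro rfl; exact hpa h.zero)
  have h1 : t < 1 := lt_of_le_of_ne ht.2 (by rintro rfl; exact hpb h.one)
  refine ⟨γ '' Icc 0 t, γ '' Icc t 1, ?_, ?_, ?_, ?_⟩
  · refine IsEdge.of_Icc h0 (h.cont.mono (Icc_subset_Icc_right h1.le)) h.zero rfl rfl ?_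
    exact fun s hs u hu => h.inj s ⟨hs.1, hs.2.trans h1.le⟩ u ⟨hu.1, hu.2.trans h1⟩
  · refine IsEdge.of_Icc h1 (h.cont.mono (Icc_subset_Icc_left h0.le)) rfl h.one rfl ?_
    exact fun s hs u hu => h.inj s ⟨h0.le.trans hs.1, hs.2⟩ u ⟨h0.trans hu.1, hu.2⟩
  · rw [← image_union, Icc_union_Icc_eq_Icc h0.le h1.le, h.image]
  · rintro _ ⟨s, hs, rfl⟩ ⟨u, hu, hus⟩
    rcases hs.1.eq_or_lt with rfl | hs0
    · rcases hu.2.eq_or_lt with rfl | hu1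
      · exact Or.inr ⟨h.zero, hus ▸ h.one⟩
      · have := h.inj 0 (by simp) u ⟨h0.trans_le hu.1, hu1⟩ hus.symm
        linarith [hu.1]
    · have := h.inj u ⟨h0.le.trans hu.1, hu.2⟩ s ⟨hs0, hs.2.trans_lt h1⟩ hus
      left
      congr 1
      linarith [hs.2, hu.1]

theorem IsEdge.image {S : Set Plane} {a b : Plane} (h : IsEdge S a b) {f : Plane → Plane}
    (hf : Continuous f) (hi : Function.Injective f) : IsEdge (f '' S) (f a) (f b) := by
  obtain ⟨γ, h⟩ := h
  refine ⟨f ∘ γ, hf.comp_continuousOn h.cont, congrArg f h.zero, congrArg f h.one, ?_,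
    fun s hs t ht hst => h.inj s hs t ht (hi hst)⟩
  rw [image_comp, h.image]

/-! ### ### Multigraphs and their realizations in the plane -/

/-- A finite multigraph: the `n` edges carry their two end points among the `m` vertices. -/
abbrev Graph (n m : ℕ) : Type := Fin n → Fin m × Fin m

/-- `X` is the union of edges `S i` that realize the multigraph `G`, with vertices at `pos`. -/
structure Realizes {n m : ℕ} (G : Graph n m) (pos : Fin m → Plane) (S : Fin n → Set Plane)
    (X : Set Plane) : Prop where
  edge : ∀ i, IsEdge (S i) (pos (G i).1) (pos (G i).2)
  inj : Function.Injective pos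
  used : ∀ v, ∃ i, v = (G i).1 ∨ v = (G i).2
  vert : ∀ i v, pos v ∈ S i → v = (G i).1 ∨ v = (G i).2
  inter : ∀ i j, i ≠ j → ∀ x ∈ S i, x ∈ S j → ∃ v, x = pos v
  union : ⋃ i, S i = X

/-- The parameter `s` of the edge `i` is mapped to the vertex `v`. -/
def Graph.At {n m : ℕ} (G : Graph n m) (i : Fin n) (s : ℝ) (v : Fin m) : Prop :=
  s = 0 ∧ v = (G i).1 ∨ s = 1 ∧ v = (G i).2

section
variable {n m : ℕ} {G : Graph n m} {pos : Fin m → Plane} {S : Fin n → Set Plane} {X : Set Plane}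

theorem Realizes.edge_subset (h : Realizes G pos S X) (i : Fin n) : S i ⊆ X :=
  h.union ▸ subset_iUnion S i

theorem Realizes.exists_edge (h : Realizes G pos S X) {x : Plane} (hx : x ∈ X) : ∃ i, x ∈ S i := by
  rw [← h.union] at hx
  exact mem_iUnion.1 hx

theorem Realizes.pos_mem_edge (h : Realizes G pos S X) {i : Fin n} {v : Fin m}
    (hv : v = (G i).1 ∨ v = (G i).2) : pos v ∈ S i := by
  rcases hv with rfl | rfl
  · exact (h.edge i).left_mem
  · exact (h.edge i).right_mem

theorem Realizes.pos_mem (h : Realizes G pos S X) (v : Fin m) : pos v ∈ X := by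
  obtain ⟨i, hi⟩ := h.used v
  exact h.edge_subset i (h.pos_mem_edge hi)

theorem Realizes.at_of_eq (h : Realizes G pos S X) {γ : ℝ → Plane} {i : Fin n}
    (hγ : EdgeParam γ (S i) (pos (G i).1) (pos (G i).2)) {s : ℝ} (hs : s ∈ Icc (0 : ℝ) 1)
    {v : Fin m} (hv : γ s = pos v) : G.At i s v := by
  rcases hs.1.eq_or_lt with rfl | h0
  · exact Or.inl ⟨rfl, h.inj (by rw [← hv, hγ.zero])⟩
  rcases hs.2.eq_or_lt with rfl | h1
  · exact Or.inr ⟨rfl, h.inj (by rw [← hv, hγ.one])⟩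
  exfalso
  have hmem : pos v ∈ S i := by rw [← hv, ← hγ.image]; exact mem_image_of_mem _ hs
  rcases h.vert i v hmem with hv' | hv'
  · have := hγ.inj 0 (by simp) s ⟨h0, h1⟩ (by rw [hγ.zero, hv, hv'])
    exact h0.ne this
  · have := hγ.inj 1 (by simp) s ⟨h0, h1⟩ (by rw [hγ.one, hv, hv'])
    exact h1.ne this.symm

theorem Realizes.eq_of_at {γ : ℝ → Plane} {i : Fin n}
    (hγ : EdgeParam γ (S i) (pos (G i).1) (pos (G i).2)) {s : ℝ}
    {v : Fin m} (hv : G.At i s v) : γ s = pos v := by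
  rcases hv with ⟨rfl, rfl⟩ | ⟨rfl, rfl⟩
  · exact hγ.zero
  · exact hγ.one

/-- The right-hand side mentions neither `pos` nor `S`: the coincidences between the
parametrizations depend on the multigraph only. -/
theorem Realizes.param_eq_iff (h : Realizes G pos S X) {γ : Fin n → ℝ → Plane}
    (hγ : ∀ i, EdgeParam (γ i) (S i) (pos (G i).1) (pos (G i).2)) {i j : Fin n} {s t : ℝ}
    (hs : s ∈ Icc (0 : ℝ) 1) (ht : t ∈ Icc (0 : ℝ) 1) :
    γ i s = γ j t ↔ (i = j ∧ s = t) ∨ ∃ v, G.At i s v ∧ G.At j t v := by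
  constructor
  · intro hst
    by_cases hij : i = j
    · subst hij
      by_cases hst' : s = t
      · exact Or.inl ⟨rfl, hst'⟩
      right
      have h1 : s ∉ Ioo (0 : ℝ) 1 := fun h1 => hst' ((hγ i).inj t ht s h1 hst.symm).symm
      have : ∃ v, G.At i s v := by
        rcases hs.1.eq_or_lt with rfl | h0
        · exact ⟨_, Or.inl ⟨rfl, rfl⟩⟩
        rcases hs.2.eq_or_lt with rfl | h2
        · exact ⟨_, Or.inr ⟨rfl, rfl⟩⟩
        exact absurd ⟨h0, h2⟩ h1
      obtain ⟨v, hv⟩ := this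
      exact ⟨v, hv, h.at_of_eq (hγ i) ht (by rw [← hst, eq_of_at (hγ i) hv])⟩
    · have hi : γ i s ∈ S i := (hγ i).image ▸ mem_image_of_mem _ hs
      have hj : γ i s ∈ S j := hst ▸ (hγ j).image ▸ mem_image_of_mem _ ht
      obtain ⟨v, hv⟩ := h.inter i j hij _ hi hj
      exact Or.inr ⟨v, h.at_of_eq (hγ i) hs hv, h.at_of_eq (hγ j) ht (hst ▸ hv)⟩
  · rintro (⟨rfl, rfl⟩ | ⟨v, hv, hw⟩)
    · rfl
    · rw [eq_of_at (hγ i) hv, eq_of_at (hγ j) hw]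

/-- A continuous surjection from a compact space to a Hausdorff space is closed, hence a quotient
map. Two realizations of `G` are therefore quotients of one space by one relation. -/
theorem Realizes.exists_quotientMap (h : Realizes G pos S X) :
    ∃ f : C(Fin n × Icc (0 : ℝ) 1, X), IsQuotientMap f ∧ ∀ x y, f x = f y ↔
      (x.1 = y.1 ∧ x.2.1 = y.2.1) ∨ ∃ v, G.At x.1 x.2.1 v ∧ G.At y.1 y.2.1 v := by
  choose γ hγ using h.edge
  have hmem : ∀ x : Fin n × Icc (0 : ℝ) 1, γ x.1 x.2.1 ∈ X := fun x =>
    h.edge_subset x.1 ((hγ x.1).image ▸ mem_image_of_mem _ x.2.2)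
  have hc : Continuous fun x : Fin n × Icc (0 : ℝ) 1 => (⟨γ x.1 x.2.1, hmem x⟩ : X) := by
    refine Continuous.subtype_mk ?_ _
    exact continuous_prod_of_discrete_left.2 fun i =>
      continuousOn_iff_continuous_domRestrict.1 (hγ i).cont
  refine ⟨⟨fun x => ⟨γ x.1 x.2.1, hmem x⟩, hc⟩, ?_, fun x y => ?_⟩
  · refine hc.isClosedMap.isQuotientMap hc ?_
    rintro ⟨x, hx⟩
    obtain ⟨i, hi⟩ := h.exists_edge hx
    rw [← (hγ i).image] at hi
    obtain ⟨t, ht, rfl⟩ := hi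
    exact ⟨(i, ⟨t, ht⟩), rfl⟩
  · rw [ContinuousMap.coe_mk, Subtype.mk.injEq]
    exact h.param_eq_iff hγ x.2.2 y.2.2

/-- A multigraph has only one realization up to homeomorphism. -/
theorem Realizes.homeomorphic (h : Realizes G pos S X) {pos' : Fin m → Plane}
    {S' : Fin n → Set Plane} {X' : Set Plane} (h' : Realizes G pos' S' X') :
    Homeomorphic X X' := by
  obtain ⟨f, hf, hf'⟩ := h.exists_quotientMap
  obtain ⟨g, hg, hg'⟩ := h'.exists_quotientMap
  have hker : Setoid.ker f = Setoid.ker g := by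
    ext x y
    rw [Setoid.ker_def, Setoid.ker_def, hf', hg']
  have e₁ := hf.homeomorph
  rw [hker] at e₁
  exact ⟨e₁.symm.trans hg.homeomorph⟩

/-- The subdivision of the edge `e`. The new vertex is `0`. -/
def Graph.subdiv (G : Graph n m) (e : Fin n) : Graph (n + 1) (m + 1) :=
  Fin.cons (0, (G e).2.succ)
    (fun i => ((G i).1.succ, if i = e then 0 else (G i).2.succ))

/-- The edge `e.succ` keeps the half from the old source to `p`, and the edge `0` is the half from
`p` to the old target. This reduces the removal of an arbitrary point to the removal of a vertex. -/
theorem Realizes.subdiv (h : Realizes G pos S X) {e : Fin n} {p : Plane} (hp : p ∈ S e)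
    (hpos : ∀ v, p ≠ pos v) :
    ∃ S', Realizes (G.subdiv e) (Fin.cons p pos : Fin (m + 1) → Plane) S' X := by
  obtain ⟨S₁, S₂, h₁, h₂, hU, hI⟩ := (h.edge e).exists_split hp (hpos _) (hpos _)
  have hS₁ : S₁ ⊆ S e := hU ▸ subset_union_left
  have hS₂ : S₂ ⊆ S e := hU ▸ subset_union_right
  have hpS : ∀ i, i ≠ e → p ∉ S i := fun i hi hpi => by
    obtain ⟨v, hv⟩ := h.inter i e hi p hpi hp
    exact hpos v hv
  set T : Fin n → Set Plane := fun i => if i = e then S₁ else S i with hT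
  have hTe : T e = S₁ := if_pos rfl
  have hTi : ∀ i, i ≠ e → T i = S i := fun i hi => if_neg hi
  have hTS : ∀ i, T i ⊆ S i := fun i => by
    by_cases hi : i = e
    · rw [hi, hTe]; exact hS₁
    · rw [hTi i hi]
  have hnew : ∀ j, ∀ x ∈ S₂, x ∈ T j → ∃ v, x = (Fin.cons p pos : Fin (m + 1) → Plane) v := by
    intro j x hx hxj
    by_cases hj : j = e
    · rw [hj, hTe] at hxj
      rcases hI x hxj hx with rfl | ⟨rfl, -⟩
      · exact ⟨0, rfl⟩
      · exact ⟨(G e).1.succ, rfl⟩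
    · obtain ⟨v, hv⟩ := h.inter e j (Ne.symm hj) x (hS₂ hx) (hTS j hxj)
      exact ⟨v.succ, hv⟩
  refine ⟨Fin.cons S₂ T, ?_, ?_, ?_, ?_, ?_, ?_⟩
  · refine Fin.cases ?_ fun i => ?_
    · simpa [Graph.subdiv] using h₂
    · by_cases hi : i = e
      · subst hi
        simpa [Graph.subdiv, hTe] using h₁
      · simpa [Graph.subdiv, hTi i hi, hi] using h.edge i
  · refine Fin.cons_injective_iff.2 ⟨?_, h.inj⟩
    rintro ⟨v, hv⟩
    exact hpos v hv.symm
  · refine Fin.cases ⟨0, Or.inl rfl⟩ fun v => ?_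
    obtain ⟨i, hi⟩ := h.used v
    -- The target of `e` is the only incidence that moves, namely to the new edge `0`.
    by_cases hie : i = e ∧ v = (G i).2
    · exact ⟨0, Or.inr (by rw [hie.2, hie.1]; rfl)⟩
    · refine ⟨i.succ, ?_⟩
      rcases hi with hi | hi
      · exact Or.inl (by rw [hi]; rfl)
      · have hne : i ≠ e := fun h => hie ⟨h, hi⟩
        exact Or.inr (by simp [Graph.subdiv, hne, hi])
  · refine Fin.cases ?_ fun i => ?_
    · refine Fin.cases (fun _ => Or.inl rfl) fun v hv => ?_
      simp only [Fin.cons_succ, Fin.cons_zero, Graph.subdiv, Fin.succ_ne_zero, false_or] at hv ⊢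
      rcases h.vert e v (hS₂ hv) with hv' | hv'
      -- The source of `e` lies on the second half only if `e` is a loop, and then it is the target
      -- too.
      · rcases hI (pos v) (hv' ▸ h₁.left_mem) hv with h3 | ⟨-, h3⟩
        · exact absurd h3.symm (hpos v)
        · rw [h.inj h3]
      · rw [hv']
    · refine Fin.cases (fun hv => ?_) fun v hv => ?_
      · simp only [Fin.cons_succ, Fin.cons_zero, Graph.subdiv] at hv ⊢
        by_cases hi : i = e
        · simp [hi]
        · exact absurd (hTS i hv) (hpS i hi)
      · simp only [Fin.cons_succ, Graph.subdiv] at hv ⊢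
        rcases h.vert i v (hTS i hv) with hv' | hv'
        · simp [hv']
        · by_cases hi : i = e
          · subst hi
            rw [hTe] at hv
            rcases hI (pos v) hv (hv' ▸ h₂.right_mem) with h3 | ⟨h3, -⟩
            · exact absurd h3.symm (hpos v)
            · rw [h.inj h3]; simp
          · simp [hi, hv']
  · refine Fin.cases ?_ fun i => ?_
    · refine Fin.cases (fun hne => absurd rfl hne) fun j _ x hx hxj => hnew j x hx hxj
    · refine Fin.cases (fun _ x hxi hx => hnew i x hx hxi) fun j hij x hxi hxj => ?_
      obtain ⟨v, hv⟩ := h.inter i j (fun h => hij (h ▸ rfl)) x (hTS i hxi) (hTS j hxj)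
      exact ⟨v.succ, hv⟩
  · rw [← h.union]
    ext x
    simp only [mem_iUnion]
    constructor
    · rintro ⟨i, hi⟩
      revert hi
      refine Fin.cases (fun hi => ⟨e, hS₂ hi⟩) (fun i hi => ⟨i, hTS i hi⟩) i
    · rintro ⟨i, hi⟩
      by_cases hie : i = e
      · rw [hie, ← hU] at hi
        rcases hi with hi | hi
        · exact ⟨e.succ, by simpa [hTe] using hi⟩
        · exact ⟨0, hi⟩
      · exact ⟨i.succ, by simpa [hTi i hie] using hi⟩

/-! ### ### Path components after the deletion of vertices -/

/-- The edges `i` and `j` have an end point in common that does not belong to `F`. -/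
def Graph.Touch (G : Graph n m) (F : Finset (Fin m)) (i j : Fin n) : Prop :=
  ((G i).1 ∉ F ∧ ((G i).1 = (G j).1 ∨ (G i).1 = (G j).2)) ∨
    ((G i).2 ∉ F ∧ ((G i).2 = (G j).1 ∨ (G i).2 = (G j).2))

instance (G : Graph n m) (F : Finset (Fin m)) : DecidableRel (G.Touch F) :=
  fun i j => by unfold Graph.Touch; infer_instance

theorem Graph.touch_iff {F : Finset (Fin m)} {i j : Fin n} : G.Touch F i j ↔
    ∃ v ∉ F, (v = (G i).1 ∨ v = (G i).2) ∧ (v = (G j).1 ∨ v = (G j).2) := by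
  unfold Graph.Touch
  aesop

/-- Between `1 / 2` and the parameter `t` of `x`, all parameters except possibly `t` itself are
interior, so the path avoids end points that are missing from `Y`. -/
theorem EdgeParam.joinedIn {γ : ℝ → Plane} {T Y : Set Plane} {a b : Plane}
    (hγ : EdgeParam γ T a b) (h : ∀ t ∈ Ioo (0 : ℝ) 1, γ t ∈ Y) {x : Plane} (hx : x ∈ T)
    (hxY : x ∈ Y) : JoinedIn Y (γ (1 / 2)) x := by
  rw [← hγ.image] at hx
  obtain ⟨t, ht, rfl⟩ := hx
  have hseg : uIcc (1 / 2) t ⊆ Icc (0 : ℝ) 1 := by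
    intro u hu
    rcases le_total (1 / 2) t with h | h
    · rw [uIcc_of_le h] at hu
      exact ⟨by linarith [hu.1], hu.2.trans ht.2⟩
    · rw [uIcc_of_ge h] at hu
      exact ⟨ht.1.trans hu.1, by linarith [hu.2]⟩
  have hpc : IsPathConnected (uIcc (1 / 2) t) :=
    (convex_uIcc _ _).isPathConnected ⟨t, right_mem_uIcc⟩
  have h2 := (hpc.image' (hγ.cont.mono hseg)).joinedIn _ (mem_image_of_mem γ left_mem_uIcc) _
    (mem_image_of_mem γ right_mem_uIcc)
  refine h2.mono ?_
  rintro _ ⟨u, hu, rfl⟩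
  by_cases hut : u = t
  · rwa [hut]
  refine h u ?_
  rcases le_total (1 / 2) t with h | h
  · rw [uIcc_of_le h] at hu
    exact ⟨by linarith [hu.1], (lt_of_le_of_ne hu.2 hut).trans_le ht.2⟩
  · rw [uIcc_of_ge h] at hu
    exact ⟨ht.1.trans_lt (lt_of_le_of_ne hu.1 (Ne.symm hut)), by linarith [hu.2]⟩

/-- The path components of a realization without some of the vertices are those of the graph. -/
theorem Realizes.numPathComponents_diff (h : Realizes G pos S X) (F : Finset (Fin m)) :
    numPathComponents (X \ pos '' F) = ENat.card (Quot (G.Touch F)) := by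
  choose γ hγ using h.edge
  set Y : Set Plane := X \ pos '' F with hY
  have hIoo : ∀ i, ∀ t ∈ Ioo (0 : ℝ) 1, γ i t ∈ Y := by
    intro i t ht
    refine ⟨h.edge_subset i ((hγ i).image ▸ mem_image_of_mem _ (Ioo_subset_Icc_self ht)), ?_⟩
    rintro ⟨v, -, hv⟩
    rcases h.at_of_eq (hγ i) (Ioo_subset_Icc_self ht) hv.symm with h3 | h3
    · exact ht.1.ne h3.1.symm
    · exact ht.2.ne h3.1
  have hposY : ∀ v ∉ F, pos v ∈ Y := fun v hv => ⟨h.pos_mem v, by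
    rintro ⟨w, hw, hwv⟩
    exact hv (h.inj hwv ▸ hw)⟩
  have hmid : ∀ i, γ i (1 / 2) ∈ Y := fun i => hIoo i _ (by norm_num)
  have hjoin : ∀ i x (hx : x ∈ S i) (hxY : x ∈ Y),
      Joined (⟨γ i (1 / 2), hmid i⟩ : Y) ⟨x, hxY⟩ := fun i x hx hxY =>
    ((hγ i).joinedIn (hIoo i) hx hxY).joined_subtype
  -- An edge is chosen through each point. Its class does not depend on the choice, since two edges
  -- through a common point of `Y` share a vertex outside `F`.
  choose c hc using fun x : Y => h.exists_edge x.2.1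
  have hc' : ∀ (x : Y) i, x.1 ∈ S i → Quot.mk (G.Touch F) (c x) = Quot.mk (G.Touch F) i := by
    intro x i hi
    by_cases hne : c x = i
    · rw [hne]
    obtain ⟨v, hv⟩ := h.inter _ _ hne _ (hc x) hi
    refine Quot.sound (Graph.touch_iff.2 ⟨v, fun hvF => ?_, h.vert _ _ (hv ▸ hc x),
      h.vert _ _ (hv ▸ hi)⟩)
    exact x.2.2 ⟨v, hvF, hv.symm⟩
  have hclosed : ∀ i, IsClosed (S i) := fun i => by
    rw [← (hγ i).image]
    exact (isCompact_Icc.image_of_continuousOn (hγ i).cont).isClosed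
  -- Preimages of all sets of classes are finite unions of closed edges. Taking complements, they
  -- are open as well, so the class is locally constant and hence constant along paths.
  have hfib : ∀ Q : Set (Quot (G.Touch F)),
      IsClosed {x : Y | Quot.mk (G.Touch F) (c x) ∈ Q} := by
    intro Q
    have : {x : Y | Quot.mk (G.Touch F) (c x) ∈ Q} =
        ⋃ i ∈ {i | Quot.mk (G.Touch F) i ∈ Q}, Subtype.val ⁻¹' S i := by
      ext x
      simp only [mem_ofPred_eq, mem_iUnion, mem_preimage, exists_prop]
      exact ⟨fun hx => ⟨c x, hx, hc x⟩, fun ⟨i, hi, hxi⟩ => hc' x i hxi ▸ hi⟩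
    rw [this]
    exact (toFinite _).isClosed_biUnion fun i _ => (hclosed i).preimage continuous_subtype_val
  have hloc : IsLocallyConstant fun x : Y => Quot.mk (G.Touch F) (c x) := fun Q =>
    isClosed_compl_iff.1 (hfib Qᶜ)
  have hconst : ∀ x y : Y, Joined x y →
      Quot.mk (G.Touch F) (c x) = Quot.mk (G.Touch F) (c y) := by
    rintro x y ⟨p⟩
    have := (hloc.comp_continuous p.continuous).apply_eq_of_preconnectedSpace 0 1
    simpa using this
  -- The bijection sends the class of an edge to the path component of its midpoint.
  refine (ENat.card_congr (Equiv.ofBijective (Quot.lift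
    (fun i => (Quotient.mk _ (⟨γ i (1 / 2), hmid i⟩ : Y) : ZerothHomotopy Y)) ?_) ⟨?_, ?_⟩)).symm
  · intro i j hij
    obtain ⟨v, hvF, hvi, hvj⟩ := Graph.touch_iff.1 hij
    exact Quotient.sound ((hjoin i _ (h.pos_mem_edge hvi) (hposY v hvF)).trans
      (hjoin j _ (h.pos_mem_edge hvj) (hposY v hvF)).symm)
  · rintro ⟨i⟩ ⟨j⟩ hij
    have h3 := hconst _ _ (Quotient.exact hij)
    rwa [hc' _ i ((hγ i).image ▸ mem_image_of_mem _ (by norm_num)),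
      hc' _ j ((hγ j).image ▸ mem_image_of_mem _ (by norm_num))] at h3
  · rintro ⟨x⟩
    exact ⟨Quot.mk _ (c x), Quotient.sound (hjoin _ _ (hc x) x.2)⟩

end

/-! ### Counting the components of a multigraph -/

section
variable {n m : ℕ}

/-- Labels of edges: after `k` rounds, the least number of an edge within `k` steps. -/
def Graph.label (G : Graph n m) (F : Finset (Fin m)) : ℕ → Fin n → ℕ
  | 0 => Fin.val
  | k + 1 => fun i => (List.finRange n).foldr
      (fun j a => if G.Touch F i j then min (G.label F k j) a else a) (G.label F k i)

/-- After three rounds the labels are constant on components, and `k` labels are in use. -/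
def Graph.HasComponents (G : Graph n m) (F : Finset (Fin m)) (k : ℕ) : Prop :=
  (∀ i j, G.Touch F i j → G.label F 3 i = G.label F 3 j) ∧
    (Finset.univ.image (G.label F 3)).card = k

instance (G : Graph n m) (F : Finset (Fin m)) (k : ℕ) : Decidable (G.HasComponents F k) := by
  unfold Graph.HasComponents; infer_instance

/-- A label is always the number of an edge of the same class, so different classes never share a
label. That three rounds suffice is not proved in general: it is the first condition of
`Graph.HasComponents`, checked for each graph. -/
theorem Graph.exists_label_eq (G : Graph n m) (F : Finset (Fin m)) (k : ℕ) (i : Fin n) :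
    ∃ j : Fin n, G.label F k i = j ∧ Quot.mk (G.Touch F) i = Quot.mk (G.Touch F) j := by
  induction k generalizing i with
  | zero => exact ⟨i, rfl, rfl⟩
  | succ k ih =>
    simp only [Graph.label]
    induction List.finRange n with
    | nil => exact ih i
    | cons j l ihl =>
      rw [List.foldr_cons]
      split_ifs with hij
      · rcases min_choice (G.label F k j) (l.foldr
          (fun j a => if G.Touch F i j then min (G.label F k j) a else a) (G.label F k i))
          with h | h
        · obtain ⟨j', h₁, h₂⟩ := ih j
          exact ⟨j', h.trans h₁, (Quot.sound hij).trans h₂⟩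
        · rw [h]
          exact ihl
      · exact ihl

theorem Graph.HasComponents.card_quot {G : Graph n m} {F : Finset (Fin m)} {k : ℕ}
    (h : G.HasComponents F k) : ENat.card (Quot (G.Touch F)) = k := by
  let f : Quot (G.Touch F) → ℕ := Quot.lift (G.label F 3) h.1
  have hf : Function.Injective f := by
    rintro ⟨i⟩ ⟨j⟩ hij
    obtain ⟨i', hi, hi'⟩ := G.exists_label_eq F 3 i
    obtain ⟨j', hj, hj'⟩ := G.exists_label_eq F 3 j
    have h3 : i' = j' := Fin.val_injective (hi.symm.trans (Eq.trans hij hj))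
    exact hi'.trans (h3 ▸ hj'.symm)
  have hr : Set.range f = (Finset.univ.image (G.label F 3) : Finset ℕ) := by
    ext x
    simp only [Finset.coe_image, Finset.coe_univ, image_univ, Set.mem_range]
    constructor
    · rintro ⟨⟨i⟩, hi⟩
      exact ⟨i, hi⟩
    · rintro ⟨i, hi⟩
      exact ⟨Quot.mk _ i, hi⟩
  rw [← h.2, ← Set.encard_coe_eq_coe_finsetCard, ← hr, ← image_univ, hf.encard_image,
    Set.encard_univ]

/-- The points of the edge `e` and the vertex `v` have intersection orders `a e` and `b v`. -/
structure Graph.Orders (G : Graph n m) (a : Fin n → ℕ) (b : Fin m → ℕ) : Prop where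
  edge : ∀ e, (G.subdiv e).HasComponents {0} (a e)
  vert : ∀ v, G.HasComponents {v} (b v)

variable {G : Graph n m} {pos : Fin m → Plane} {S : Fin n → Set Plane} {X : Set Plane}

theorem Realizes.numPathComponents_eq (h : Realizes G pos S X) {F : Finset (Fin m)} {k : ℕ}
    (hk : G.HasComponents F k) : numPathComponents (X \ pos '' F) = k := by
  rw [h.numPathComponents_diff, hk.card_quot]

theorem Realizes.order_vertex (h : Realizes G pos S X) {v : Fin m} {k : ℕ}
    (hk : G.HasComponents {v} k) : intersectionOrder X (pos v) = k := by
  simpa [intersectionOrder] using h.numPathComponents_eq hk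

theorem Realizes.order_vertex_diff (h : Realizes G pos S X) {v w : Fin m} {k : ℕ}
    (hk : G.HasComponents {v, w} k) :
    intersectionOrder (X \ {pos v}) (pos w) = k := by
  rw [intersectionOrder, sdiff_sdiff, ← h.numPathComponents_eq hk, Finset.coe_insert,
    Finset.coe_singleton, image_pair]
  rfl

theorem Realizes.order_edge (h : Realizes G pos S X) {e : Fin n} {k : ℕ}
    (hk : (G.subdiv e).HasComponents {0} k) {p : Plane} (hp : p ∈ S e) (hpos : ∀ v, p ≠ pos v) :
    intersectionOrder X p = k := by
  obtain ⟨S', h'⟩ := h.subdiv hp hpos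
  exact h'.order_vertex hk

theorem Realizes.infinite_edge (h : Realizes G pos S X) (e : Fin n) :
    {p | p ∈ S e ∧ ∀ v, p ≠ pos v}.Infinite := by
  obtain ⟨γ, hγ⟩ := h.edge e
  have hinj : InjOn γ (Ioo 0 1) := fun s hs t ht => hγ.inj s (Ioo_subset_Icc_self hs) t ht
  refine ((Ioo_infinite (zero_lt_one' ℝ)).image hinj).mono ?_
  rintro _ ⟨t, ht, rfl⟩
  refine ⟨hγ.image ▸ mem_image_of_mem _ (Ioo_subset_Icc_self ht), fun v hv => ?_⟩
  rcases h.at_of_eq hγ (Ioo_subset_Icc_self ht) hv with h3 | h3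
  · exact ht.1.ne h3.1.symm
  · exact ht.2.ne h3.1

/-- Each edge has infinitely many points that are not vertices, all of the same order. An order that
is not the order of an edge can be attained at vertices only. -/
theorem Realizes.orderCount_eq (h : Realizes G pos S X) {a : Fin n → ℕ} {b : Fin m → ℕ}
    (hG : G.Orders a b) (k : ℕ) : orderCount k X =
      if k ∈ List.ofFn a then ⊤ else ((List.ofFn b).count k : ℕ∞) := by
  split_ifs with hk
  · obtain ⟨e, he⟩ := (List.mem_ofFn' _ _).1 hk
    refine Set.encard_eq_top ((h.infinite_edge e).mono ?_)
    rintro p ⟨hp, hpos⟩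
    exact ⟨h.edge_subset e hp, by rw [h.order_edge (hG.edge e) hp hpos, he]⟩
  · have : {p | p ∈ X ∧ intersectionOrder X p = k} =
        pos '' (Finset.univ.filter fun v => k = b v : Finset (Fin m)) := by
      ext p
      simp only [mem_ofPred_eq, mem_image, Finset.coe_filter, Finset.mem_univ, true_and]
      constructor
      · rintro ⟨hp, ho⟩
        by_cases hv : ∃ v, p = pos v
        · obtain ⟨v, rfl⟩ := hv
          rw [h.order_vertex (hG.vert v)] at ho
          exact ⟨v, (Nat.cast_injective ho).symm, rfl⟩
        · push Not at hv
          obtain ⟨e, he⟩ := h.exists_edge hp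
          rw [h.order_edge (hG.edge e) he hv] at ho
          exact absurd ((List.mem_ofFn' _ _).2 ⟨e, Nat.cast_injective ho⟩) hk
      · rintro ⟨v, hv, rfl⟩
        exact ⟨h.pos_mem v, by rw [h.order_vertex (hG.vert v), hv]⟩
    rw [orderCount, this, h.inj.encard_image, Set.encard_coe_eq_coe_finsetCard]
    congr 1
    rw [← Multiset.coe_count, ← Fin.univ_val_map, Multiset.count_map]
    rfl

end

/-! ### ### The nine multigraphs and their intersection orders -/

def arcGraph : Graph 1 2 := ![(0, 1)]
def circleGraph : Graph 1 1 := ![(0, 0)]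
def thetaGraph : Graph 3 2 := ![(0, 1), (0, 1), (0, 1)]
def tripodGraph : Graph 3 4 := ![(0, 1), (0, 2), (0, 3)]
def crossGraph : Graph 4 5 := ![(0, 1), (0, 2), (0, 3), (0, 4)]
def doubleTripodGraph : Graph 5 6 := ![(0, 1), (0, 2), (0, 3), (1, 4), (1, 5)]
def twoTailGraph : Graph 4 4 := ![(0, 1), (0, 1), (0, 2), (1, 3)]
def tailGraph : Graph 2 2 := ![(0, 0), (0, 1)]
def crossedCircleGraph : Graph 3 3 := ![(0, 0), (0, 1), (0, 2)]

theorem arcGraph_orders : arcGraph.Orders ![2] ![1, 1] := ⟨by decide, by decide⟩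
theorem circleGraph_orders : circleGraph.Orders ![1] ![1] := ⟨by decide, by decide⟩
theorem thetaGraph_orders : thetaGraph.Orders ![1, 1, 1] ![1, 1] := ⟨by decide, by decide⟩
theorem tripodGraph_orders : tripodGraph.Orders ![2, 2, 2] ![3, 1, 1, 1] :=
  ⟨by decide, by decide⟩
theorem crossGraph_orders : crossGraph.Orders ![2, 2, 2, 2] ![4, 1, 1, 1, 1] :=
  ⟨by decide +kernel, by decide +kernel⟩
theorem doubleTripodGraph_orders : doubleTripodGraph.Orders ![2, 2, 2, 2, 2] ![3, 3, 1, 1, 1, 1] :=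
  ⟨by decide +kernel, by decide +kernel⟩
theorem twoTailGraph_orders : twoTailGraph.Orders ![1, 1, 2, 2] ![2, 2, 1, 1] :=
  ⟨by decide +kernel, by decide +kernel⟩
theorem tailGraph_orders : tailGraph.Orders ![1, 2] ![2, 1] := ⟨by decide, by decide⟩
theorem crossedCircleGraph_orders : crossedCircleGraph.Orders ![1, 2, 2] ![3, 1, 1] :=
  ⟨by decide +kernel, by decide +kernel⟩

/-! ### Strokes -/

theorem isEdge_seg {a b c d : ℝ} (h : a ≠ c ∨ b ≠ d) : IsEdge (seg a b c d) (a, b) (c, d) := by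
  refine IsEdge.of_Icc (γ := fun t => (a + t * (c - a), b + t * (d - b))) zero_lt_one
    (by fun_prop) (by simp) (by simp) ?_ ?_
  · rw [seg, segment_eq_image']
    simp
  · intro s _ t _ hst
    simp only [Prod.mk.injEq, add_right_inj, mul_eq_mul_right_iff, sub_eq_zero] at hst
    rcases h with h | h
    · exact hst.1.resolve_right (Ne.symm h)
    · exact hst.2.resolve_right (Ne.symm h)

theorem seg_comm (a b c d : ℝ) : seg a b c d = seg c d a b := segment_symm _ _ _

/-- The equation of the line is cleared of denominators, so that for concrete strokes membership
becomes linear conditions on `x` and `y`, within reach of `grind`. -/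
theorem mem_seg_of_lt {a b c d : ℝ} (h : a < c) {x y : ℝ} : (x, y) ∈ seg a b c d ↔
    a ≤ x ∧ x ≤ c ∧ (y - b) * (c - a) = (x - a) * (d - b) := by
  have hca : 0 < c - a := sub_pos.2 h
  rw [seg, segment_eq_image']
  simp only [mem_image, mem_Icc, Prod.mk_sub_mk, Prod.smul_mk, smul_eq_mul, Prod.mk_add_mk,
    Prod.mk.injEq]
  constructor
  · rintro ⟨t, ⟨h0, h1⟩, rfl, rfl⟩
    exact ⟨by nlinarith, by nlinarith, by ring⟩
  · rintro ⟨h1, h2, h3⟩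
    refine ⟨(x - a) / (c - a), ⟨div_nonneg (by linarith) hca.le,
      (div_le_one hca).2 (by linarith)⟩, by field_simp; ring, ?_⟩
    rw [div_mul_eq_mul_div, ← h3]
    field_simp
    ring

theorem mem_seg_of_gt {a b c d : ℝ} (h : c < a) {x y : ℝ} : (x, y) ∈ seg a b c d ↔
    c ≤ x ∧ x ≤ a ∧ (y - d) * (a - c) = (x - c) * (b - d) := by
  rw [seg_comm, mem_seg_of_lt h]

theorem mem_seg_vertical {a b d : ℝ} (h : b < d) {x y : ℝ} : (x, y) ∈ seg a b a d ↔
    x = a ∧ b ≤ y ∧ y ≤ d := by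
  have hdb : 0 < d - b := sub_pos.2 h
  rw [seg, segment_eq_image']
  simp only [mem_image, mem_Icc, Prod.mk_sub_mk, Prod.smul_mk, smul_eq_mul, Prod.mk_add_mk,
    Prod.mk.injEq]
  constructor
  · rintro ⟨t, ⟨h0, h1⟩, rfl, rfl⟩
    exact ⟨by ring, by nlinarith, by nlinarith⟩
  · rintro ⟨rfl, h2, h3⟩
    exact ⟨(y - b) / (d - b), ⟨div_nonneg (by linarith) hdb.le,
      (div_le_one hdb).2 (by linarith)⟩, by ring, by field_simp; ring⟩

theorem mem_seg_vertical' {a b d : ℝ} (h : d < b) {x y : ℝ} : (x, y) ∈ seg a b a d ↔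
    x = a ∧ d ≤ y ∧ y ≤ b := by
  rw [seg_comm, mem_seg_vertical h]

theorem mem_circ {a b r x y : ℝ} : (x, y) ∈ circ a b r ↔ (x - a) ^ 2 + (y - b) ^ 2 = r ^ 2 :=
  Iff.rfl

/-- The part of the right (`σ = 1`) or left (`σ = -1`) half circle where `c ≤ y ≤ d`. -/
def arcY (σ a b r c d : ℝ) : Set Plane :=
  {p | (p.1 - a) ^ 2 + (p.2 - b) ^ 2 = r ^ 2 ∧ 0 ≤ σ * (p.1 - a) ∧ c ≤ p.2 ∧ p.2 ≤ d}

/-- The part of the upper (`σ = 1`) or lower (`σ = -1`) half circle where `c ≤ x ≤ d`. -/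
def arcX (σ a b r c d : ℝ) : Set Plane :=
  {p | (p.1 - a) ^ 2 + (p.2 - b) ^ 2 = r ^ 2 ∧ 0 ≤ σ * (p.2 - b) ∧ c ≤ p.1 ∧ p.1 ≤ d}

theorem mem_arcY {σ a b r c d x y : ℝ} : (x, y) ∈ arcY σ a b r c d ↔
    (x - a) ^ 2 + (y - b) ^ 2 = r ^ 2 ∧ 0 ≤ σ * (x - a) ∧ c ≤ y ∧ y ≤ d := Iff.rfl

theorem mem_arcX {σ a b r c d x y : ℝ} : (x, y) ∈ arcX σ a b r c d ↔
    (x - a) ^ 2 + (y - b) ^ 2 = r ^ 2 ∧ 0 ≤ σ * (y - b) ∧ c ≤ x ∧ x ≤ d := Iff.rfl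

/-- A right or left half circle is a graph over `y`, namely `x = a + σ * √(r ^ 2 - (y - b) ^ 2)`.
The end points enter through membership, so that no square root has to be evaluated there. -/
theorem isEdge_arcY {σ a b r c d : ℝ} (hσ : σ ^ 2 = 1) (hcd : c < d) (hc : b - r ≤ c)
    (hd : d ≤ b + r) {x₀ x₁ : ℝ} (h₀ : (x₀, c) ∈ arcY σ a b r c d)
    (h₁ : (x₁, d) ∈ arcY σ a b r c d) : IsEdge (arcY σ a b r c d) (x₀, c) (x₁, d) := by
  have key : ∀ x y, (x, y) ∈ arcY σ a b r c d → a + σ * √(r ^ 2 - (y - b) ^ 2) = x := by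
    rintro x y ⟨h₁, h₂, -⟩
    have : √(r ^ 2 - (y - b) ^ 2) = σ * (x - a) := by
      rw [← Real.sqrt_sq h₂]
      congr 1
      simp only at h₁
      linear_combination (-(x - a) ^ 2) * hσ - h₁
    rw [this]
    linear_combination (x - a) * hσ
  refine IsEdge.of_Icc (γ := fun y => (a + σ * √(r ^ 2 - (y - b) ^ 2), y)) hcd (by fun_prop)
    (by simp only [key _ _ h₀]) (by simp only [key _ _ h₁]) ?_ ?_
  · ext ⟨x, y⟩
    constructor
    · rintro ⟨t, ht, h⟩
      obtain ⟨rfl, rfl⟩ := Prod.mk.inj h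
      have hnn : 0 ≤ r ^ 2 - (t - b) ^ 2 := by nlinarith [ht.1, ht.2]
      refine mem_arcY.2 ⟨?_, ?_, ht⟩
      · rw [add_sub_cancel_left, mul_pow, hσ, Real.sq_sqrt hnn]
        ring
      · rw [add_sub_cancel_left, ← mul_assoc, ← sq, hσ, one_mul]
        exact Real.sqrt_nonneg _
    · intro h
      exact ⟨y, h.2.2, by simp only [key _ _ h]⟩
  · intro s _ t _ h
    exact (Prod.mk.inj h).2

theorem isEdge_arcX {σ a b r c d : ℝ} (hσ : σ ^ 2 = 1) (hcd : c < d) (hc : a - r ≤ c)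
    (hd : d ≤ a + r) {y₀ y₁ : ℝ} (h₀ : (c, y₀) ∈ arcX σ a b r c d)
    (h₁ : (d, y₁) ∈ arcX σ a b r c d) : IsEdge (arcX σ a b r c d) (c, y₀) (d, y₁) := by
  have hswap : Prod.swap '' arcY σ b a r c d = arcX σ a b r c d := by
    ext ⟨x, y⟩
    rw [image_swap_eq_preimage_swap, mem_preimage, Prod.swap_prod_mk, mem_arcX, mem_arcY, add_comm]
  have := (isEdge_arcY hσ hcd hc hd (x₀ := y₀) (x₁ := y₁)
    (by rwa [mem_arcY, add_comm, ← mem_arcX]) (by rwa [mem_arcY, add_comm, ← mem_arcX])).image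
    continuous_swap Prod.swap_injective
  rwa [hswap] at this

/-- Criterion for a realization in terms of the pairwise intersections of the edges. -/
theorem Realizes.of_inter {n m : ℕ} {G : Graph n m} {pos : Fin m → Plane} {S : Fin n → Set Plane}
    {X : Set Plane} (edge : ∀ i, IsEdge (S i) (pos (G i).1) (pos (G i).2))
    (inj : Function.Injective pos) (used : ∀ v, ∃ i, v = (G i).1 ∨ v = (G i).2)
    (inter : ∀ i j, i < j → ∀ x ∈ S i, x ∈ S j →
      (x = pos (G i).1 ∨ x = pos (G i).2) ∧ (x = pos (G j).1 ∨ x = pos (G j).2))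
    (union : ⋃ i, S i = X) : Realizes G pos S X := by
  have inter' : ∀ i j, i ≠ j → ∀ x ∈ S i, x ∈ S j → x = pos (G i).1 ∨ x = pos (G i).2 := by
    intro i j hij x hi hj
    rcases hij.lt_or_gt with h | h
    · exact (inter i j h x hi hj).1
    · exact (inter j i h x hj hi).2
  refine ⟨edge, inj, used, ?_, ?_, union⟩
  · intro i v hv
    obtain ⟨j, hj⟩ := used v
    by_cases hij : i = j
    · rwa [hij]
    have hvj : pos v ∈ S j := by
      rcases hj with rfl | rfl
      · exact (edge j).left_mem
      · exact (edge j).right_mem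
    exact (inter' i j hij _ hv hvj).imp (fun h => inj h) fun h => inj h
  · intro i j hij x hi hj
    rcases inter' i j hij x hi hj with h | h
    · exact ⟨_, h⟩
    · exact ⟨_, h⟩

theorem Realizes.of_isEdge {X : Set Plane} {a b : Plane} (h : IsEdge X a b) (hab : a ≠ b) :
    Realizes arcGraph ![a, b] ![X] X := by
  refine .of_inter ?_ ?_ (by decide) ?_ (by ext; simp)
  · simpa [arcGraph] using h
  · intro i j
    fin_cases i <;> fin_cases j <;> simp [hab, hab.symm]
  · intro i j hij
    exact absurd (Subsingleton.elim i j) hij.ne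

/-! ### Arcs and closed curves -/

/-- The right and left halves of `circ 10 10 10` meet on `x = 10`; this locates the common points
for `grind`. -/
theorem eq_or_eq_of_sq {y : ℝ} (h : (y - 10) ^ 2 = 100) : y = 0 ∨ y = 20 := by
  grind

theorem circ_inter_le_fst {a b r c d : ℝ} (hr : 0 ≤ r) (hc : b - r = c) (hd : b + r = d) :
    circ a b r ∩ {p | a ≤ p.1} = arcY 1 a b r c d := by
  ext ⟨x, y⟩
  simp only [mem_inter_iff, mem_circ, mem_ofPred_eq, mem_arcY]
  constructor
  · rintro ⟨h₁, h₂⟩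
    have := abs_le_of_sq_le_sq' (show (y - b) ^ 2 ≤ r ^ 2 by nlinarith [sq_nonneg (x - a)]) hr
    exact ⟨h₁, by linarith, by linarith, by linarith⟩
  · rintro ⟨h₁, h₂, -⟩
    exact ⟨h₁, by linarith⟩

theorem circ_inter_fst_le {a b r c d : ℝ} (hr : 0 ≤ r) (hc : b - r = c) (hd : b + r = d) :
    circ a b r ∩ {p | p.1 ≤ a} = arcY (-1) a b r c d := by
  ext ⟨x, y⟩
  simp only [mem_inter_iff, mem_circ, mem_ofPred_eq, mem_arcY]
  constructor
  · rintro ⟨h₁, h₂⟩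
    have := abs_le_of_sq_le_sq' (show (y - b) ^ 2 ≤ r ^ 2 by nlinarith [sq_nonneg (x - a)]) hr
    exact ⟨h₁, by linarith, by linarith, by linarith⟩
  · rintro ⟨h₁, h₂, -⟩
    exact ⟨h₁, by linarith⟩

theorem circ_inter_snd_le {a b r c d : ℝ} (hr : 0 ≤ r) (hc : a - r = c) (hd : a + r = d) :
    circ a b r ∩ {p | p.2 ≤ b} = arcX (-1) a b r c d := by
  ext ⟨x, y⟩
  simp only [mem_inter_iff, mem_circ, mem_ofPred_eq, mem_arcX]
  constructor
  · rintro ⟨h₁, h₂⟩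
    have := abs_le_of_sq_le_sq' (show (x - a) ^ 2 ≤ r ^ 2 by nlinarith [sq_nonneg (y - b)]) hr
    exact ⟨h₁, by linarith, by linarith, by linarith⟩
  · rintro ⟨h₁, h₂, -⟩
    exact ⟨h₁, by linarith⟩

theorem circ_eq_union {a b r c d : ℝ} (hr : 0 ≤ r) (hc : b - r = c) (hd : b + r = d) :
    circ a b r = arcY 1 a b r c d ∪ arcY (-1) a b r c d := by
  rw [← circ_inter_le_fst hr hc hd, ← circ_inter_fst_le hr hc hd, ← inter_union_distrib_left]
  refine (inter_eq_left.2 fun p _ => ?_).symm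
  exact le_total a p.1

theorem arcY_union {σ a b r c d e : ℝ} (hc : c ≤ d) (hd : d ≤ e) :
    arcY σ a b r c d ∪ arcY σ a b r d e = arcY σ a b r c e := by
  ext ⟨x, y⟩
  simp only [mem_union, mem_arcY]
  constructor
  · rintro (h | h)
    · exact ⟨h.1, h.2.1, h.2.2.1, h.2.2.2.trans hd⟩
    · exact ⟨h.1, h.2.1, hc.trans h.2.2.1, h.2.2.2⟩
  · intro h
    exact (le_total y d).imp (fun h' => ⟨h.1, h.2.1, h.2.2.1, h'⟩)
      fun h' => ⟨h.1, h.2.1, h', h.2.2.2⟩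

/-- The line `x = 16` cuts the circle at the heights `2` and `18`, by the triangle with sides 6, 8,
10. Each of the three pieces is a graph over `y`. -/
theorem circ_inter_fst_le_sixteen : circ 10 10 10 ∩ {p | p.1 ≤ 16} =
    arcY 1 10 10 10 18 20 ∪ arcY (-1) 10 10 10 0 20 ∪ arcY 1 10 10 10 0 2 := by
  rw [circ_eq_union (c := 0) (d := 20) (by norm_num) (by norm_num) (by norm_num)]
  ext ⟨x, y⟩
  simp only [mem_inter_iff, mem_ofPred_eq, mem_arcY, mem_union]
  constructor
  · rintro ⟨h | h, hx⟩
    · rcases le_total 10 y with hy | hy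
      · exact Or.inl (Or.inl ⟨h.1, h.2.1, by nlinarith, h.2.2.2⟩)
      · exact Or.inr ⟨h.1, h.2.1, h.2.2.1, by nlinarith⟩
    · exact Or.inl (Or.inr h)
  · rintro ((h | h) | h)
    · exact ⟨Or.inl ⟨h.1, h.2.1, by linarith, h.2.2.2⟩, by nlinarith⟩
    · exact ⟨Or.inr h, by linarith⟩
    · exact ⟨Or.inl ⟨h.1, h.2.1, h.2.2.1, by linarith⟩, by nlinarith⟩

theorem isEdge_C : IsEdge (Letter.shape .C) (16, 18) (16, 2) := by
  rw [Letter.shape, circ_inter_fst_le_sixteen]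
  -- The explicit junctions fix the abscissas of the ends of the arcs, which the sets themselves do
  -- not display. All side conditions are arithmetic.
  refine ((isEdge_arcY ?_ ?_ ?_ ?_ ?_ ?_).trans (b := ((10, 20) : Plane))
    (isEdge_arcY ?_ ?_ ?_ ?_ ?_ ?_).symm ?_ ?_ ?_).trans (b := ((10, 0) : Plane))
    (isEdge_arcY ?_ ?_ ?_ ?_ ?_ ?_) ?_ ?_ ?_
  any_goals norm_num [mem_arcY]
  all_goals grind [eq_or_eq_of_sq]

theorem isEdge_I : IsEdge (Letter.shape .I) (0, 0) (0, 20) := isEdge_seg (by norm_num)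

theorem isEdge_J : IsEdge (Letter.shape .J) (10, 20) (0, 5) := by
  rw [Letter.shape, circ_inter_snd_le (c := 0) (d := 10) (by norm_num) (by norm_num) (by norm_num)]
  refine (isEdge_seg ?_).symm.trans (isEdge_arcX ?_ ?_ ?_ ?_ ?_ ?_).symm ?_ ?_ ?_
  any_goals norm_num [mem_arcX, mem_seg_vertical]
  all_goals grind

theorem isEdge_L : IsEdge (Letter.shape .L) (0, 20) (11, 0) := by
  unfold Letter.shape
  refine (isEdge_seg ?_).symm.trans (isEdge_seg ?_) ?_ ?_ ?_
  any_goals norm_num [mem_seg_of_lt, mem_seg_vertical]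
  all_goals grind

theorem isEdge_M : IsEdge (Letter.shape .M) (0, 0) (18, 0) := by
  unfold Letter.shape
  refine (((isEdge_seg ?_).trans (isEdge_seg ?_) ?_ ?_ ?_).trans (isEdge_seg ?_) ?_ ?_ ?_).trans
    (isEdge_seg ?_) ?_ ?_ ?_
  any_goals norm_num [mem_seg_of_lt, mem_seg_vertical, mem_seg_vertical']
  all_goals grind

theorem isEdge_N : IsEdge (Letter.shape .N) (0, 0) (14, 20) := by
  unfold Letter.shape
  refine ((isEdge_seg ?_).trans (isEdge_seg ?_) ?_ ?_ ?_).trans (isEdge_seg ?_) ?_ ?_ ?_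
  any_goals norm_num [mem_seg_of_lt, mem_seg_vertical]
  all_goals grind

/-- The tips `(10, 18)` and `(2, 2)` come from the triangle with sides 3, 4, 5. Beyond the half
circles, the conditions `18 ≤ y` and `y ≤ 2` cut out short arcs that are graphs over `x`. -/
theorem shape_S : Letter.shape .S = (arcX 1 6 15 5 6 10 ∪ arcY (-1) 6 15 5 10 20) ∪
    (arcY 1 6 5 5 0 10 ∪ arcX (-1) 6 5 5 2 6) := by
  rw [← circ_inter_fst_le (c := 10) (d := 20) (by norm_num) (by norm_num) (by norm_num),
    ← circ_inter_le_fst (c := 0) (d := 10) (by norm_num) (by norm_num) (by norm_num)]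
  ext ⟨x, y⟩
  simp only [Letter.shape, mem_inter_iff, mem_circ, mem_ofPred_eq, mem_arcX, mem_union]
  constructor
  · rintro (⟨h, h'⟩ | ⟨h, h'⟩)
    · by_cases hx : x ≤ 6
      · grind
      · have := h'.resolve_left hx
        exact Or.inl (Or.inl ⟨h, by linarith, by linarith, by nlinarith⟩)
    · by_cases hx : 6 ≤ x
      · grind
      · have := h'.resolve_left hx
        exact Or.inr (Or.inr ⟨h, by linarith, by nlinarith, by linarith⟩)
  · rintro ((h | h) | (h | h))
    · exact Or.inl ⟨h.1, Or.inr (by nlinarith)⟩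
    · grind
    · grind
    · exact Or.inr ⟨h.1, Or.inr (by nlinarith)⟩

theorem isEdge_S : IsEdge (Letter.shape .S) (10, 18) (2, 2) := by
  rw [shape_S]
  refine ((isEdge_arcX ?_ ?_ ?_ ?_ ?_ ?_).symm.trans (isEdge_arcY ?_ ?_ ?_ ?_ ?_ ?_).symm
    ?_ ?_ ?_).trans (b := ((6, 10) : Plane)) ((isEdge_arcY ?_ ?_ ?_ ?_ ?_ ?_).symm.trans
      (isEdge_arcX ?_ ?_ ?_ ?_ ?_ ?_).symm ?_ ?_ ?_) ?_ ?_ ?_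
  any_goals norm_num [mem_arcX, mem_arcY]
  all_goals grind

theorem isEdge_U : IsEdge (Letter.shape .U) (0, 20) (14, 20) := by
  rw [Letter.shape, circ_inter_snd_le (c := 0) (d := 14) (by norm_num) (by norm_num)
      (by norm_num), union_right_comm]
  refine ((isEdge_seg ?_).symm.trans (isEdge_arcX ?_ ?_ ?_ ?_ ?_ ?_) ?_ ?_ ?_).trans
    (isEdge_seg ?_) ?_ ?_ ?_
  any_goals norm_num [mem_arcX, mem_seg_vertical]
  all_goals grind

theorem isEdge_V : IsEdge (Letter.shape .V) (0, 20) (16, 20) := by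
  unfold Letter.shape
  refine (isEdge_seg ?_).trans (isEdge_seg ?_) ?_ ?_ ?_
  any_goals norm_num [mem_seg_of_lt]
  all_goals grind

theorem isEdge_W : IsEdge (Letter.shape .W) (0, 20) (24, 20) := by
  unfold Letter.shape
  refine (((isEdge_seg ?_).trans (isEdge_seg ?_) ?_ ?_ ?_).trans (isEdge_seg ?_) ?_ ?_ ?_).trans
    (isEdge_seg ?_) ?_ ?_ ?_
  any_goals norm_num [mem_seg_of_lt]
  all_goals grind

theorem isEdge_Z : IsEdge (Letter.shape .Z) (0, 20) (13, 0) := by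
  unfold Letter.shape
  refine ((isEdge_seg ?_).trans (isEdge_seg ?_) ?_ ?_ ?_).trans (isEdge_seg ?_) ?_ ?_ ?_
  any_goals norm_num [mem_seg_of_lt, mem_seg_of_gt]
  all_goals grind

/-- The curve runs up the stem, along the top bar, down the bowl and back; the last concatenation
closes it up at `(0, 0)`. -/
theorem isEdge_D : IsEdge (Letter.shape .D) (0, 0) (0, 0) := by
  rw [Letter.shape, circ_inter_le_fst (c := 0) (d := 20) (by norm_num) (by norm_num)
      (by norm_num), union_right_comm]
  refine (((isEdge_seg ?_).trans (isEdge_seg ?_) ?_ ?_ ?_).trans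
    (isEdge_arcY ?_ ?_ ?_ ?_ ?_ ?_).symm ?_ ?_ ?_).trans (isEdge_seg ?_).symm ?_ ?_ ?_
  any_goals norm_num [mem_arcY, mem_seg_vertical, mem_seg_of_lt]
  all_goals grind

theorem isEdge_O : IsEdge (Letter.shape .O) (10, 0) (10, 0) := by
  rw [Letter.shape, circ_eq_union (c := 0) (d := 20) (by norm_num) (by norm_num) (by norm_num)]
  refine (isEdge_arcY ?_ ?_ ?_ ?_ ?_ ?_).trans (b := ((10, 20) : Plane))
    (isEdge_arcY ?_ ?_ ?_ ?_ ?_ ?_).symm ?_ ?_ ?_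
  any_goals norm_num [mem_arcY]
  all_goals grind

/-! ### Realizations of the remaining graphs -/

section
variable {S T U V W : Set Plane} {a b p q r s : Plane}

theorem Realizes.of_loop (h : IsEdge S a a) : Realizes circleGraph ![a] ![S] S := by
  refine .of_inter ?_ (Function.injective_of_subsingleton _) (by decide) ?_ (by ext; simp)
  · simpa [circleGraph] using h
  · intro i j hij
    exact absurd (Subsingleton.elim i j) hij.ne

theorem Realizes.theta (hS : IsEdge S a b) (hT : IsEdge T a b) (hU : IsEdge U a b)
    (inj : Function.Injective ![a, b]) (hST : ∀ x ∈ S, x ∈ T → x = a ∨ x = b)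
    (hSU : ∀ x ∈ S, x ∈ U → x = a ∨ x = b) (hTU : ∀ x ∈ T, x ∈ U → x = a ∨ x = b) :
    Realizes thetaGraph ![a, b] ![S, T, U] (S ∪ T ∪ U) := by
  refine .of_inter ?_ inj (by decide) ?_ ?_
  · simp [Fin.forall_fin_succ, thetaGraph, hS, hT, hU]
  · simp [-Prod.forall, Fin.forall_fin_succ, thetaGraph]
    and_intros <;> grind
  · ext; simp [Fin.exists_fin_succ, or_assoc]

theorem Realizes.tripod (hS : IsEdge S a p) (hT : IsEdge T a q) (hU : IsEdge U a r)
    (inj : Function.Injective ![a, p, q, r]) (hST : ∀ x ∈ S, x ∈ T → x = a)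
    (hSU : ∀ x ∈ S, x ∈ U → x = a) (hTU : ∀ x ∈ T, x ∈ U → x = a) :
    Realizes tripodGraph ![a, p, q, r] ![S, T, U] (S ∪ T ∪ U) := by
  refine .of_inter ?_ inj (by decide) ?_ ?_
  · simp [Fin.forall_fin_succ, tripodGraph, hS, hT, hU]
  · simp [-Prod.forall, Fin.forall_fin_succ, tripodGraph]
    and_intros <;> grind
  · ext; simp [Fin.exists_fin_succ, or_assoc]

theorem Realizes.cross (hS : IsEdge S a p) (hT : IsEdge T a q) (hU : IsEdge U a r)
    (hV : IsEdge V a s) (inj : Function.Injective ![a, p, q, r, s])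
    (hST : ∀ x ∈ S, x ∈ T → x = a) (hSU : ∀ x ∈ S, x ∈ U → x = a) (hSV : ∀ x ∈ S, x ∈ V → x = a)
    (hTU : ∀ x ∈ T, x ∈ U → x = a) (hTV : ∀ x ∈ T, x ∈ V → x = a) (hUV : ∀ x ∈ U, x ∈ V → x = a) :
    Realizes crossGraph ![a, p, q, r, s] ![S, T, U, V] (S ∪ T ∪ U ∪ V) := by
  refine .of_inter ?_ inj (by decide) ?_ ?_
  · simp [Fin.forall_fin_succ, crossGraph, hS, hT, hU, hV]
  · simp [-Prod.forall, Fin.forall_fin_succ, crossGraph]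
    and_intros <;> grind
  · ext; simp [Fin.exists_fin_succ, or_assoc]

theorem Realizes.doubleTripod (hS : IsEdge S a b) (hT : IsEdge T a p) (hU : IsEdge U a q)
    (hV : IsEdge V b r) (hW : IsEdge W b s) (inj : Function.Injective ![a, b, p, q, r, s])
    (hST : ∀ x ∈ S, x ∈ T → x = a) (hSU : ∀ x ∈ S, x ∈ U → x = a) (hSV : ∀ x ∈ S, x ∈ V → x = b)
    (hSW : ∀ x ∈ S, x ∈ W → x = b) (hTU : ∀ x ∈ T, x ∈ U → x = a) (hTV : ∀ x ∈ T, x ∉ V)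
    (hTW : ∀ x ∈ T, x ∉ W) (hUV : ∀ x ∈ U, x ∉ V) (hUW : ∀ x ∈ U, x ∉ W)
    (hVW : ∀ x ∈ V, x ∈ W → x = b) :
    Realizes doubleTripodGraph ![a, b, p, q, r, s] ![S, T, U, V, W] (S ∪ T ∪ U ∪ V ∪ W) := by
  refine .of_inter ?_ inj (by decide) ?_ ?_
  · simp [Fin.forall_fin_succ, doubleTripodGraph, hS, hT, hU, hV, hW]
  · simp [-Prod.forall, Fin.forall_fin_succ, doubleTripodGraph]
    and_intros <;> grind
  · ext; simp [Fin.exists_fin_succ, or_assoc]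

theorem Realizes.twoTail (hS : IsEdge S a b) (hT : IsEdge T a b) (hU : IsEdge U a p)
    (hV : IsEdge V b q) (inj : Function.Injective ![a, b, p, q])
    (hST : ∀ x ∈ S, x ∈ T → x = a ∨ x = b) (hSU : ∀ x ∈ S, x ∈ U → x = a)
    (hSV : ∀ x ∈ S, x ∈ V → x = b) (hTU : ∀ x ∈ T, x ∈ U → x = a)
    (hTV : ∀ x ∈ T, x ∈ V → x = b) (hUV : ∀ x ∈ U, x ∉ V) :
    Realizes twoTailGraph ![a, b, p, q] ![S, T, U, V] (S ∪ T ∪ U ∪ V) := by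
  refine .of_inter ?_ inj (by decide) ?_ ?_
  · simp [Fin.forall_fin_succ, twoTailGraph, hS, hT, hU, hV]
  · simp [-Prod.forall, Fin.forall_fin_succ, twoTailGraph]
    and_intros <;> grind
  · ext; simp [Fin.exists_fin_succ, or_assoc]

theorem Realizes.tail (hS : IsEdge S a a) (hT : IsEdge T a p)
    (inj : Function.Injective ![a, p]) (hST : ∀ x ∈ S, x ∈ T → x = a) :
    Realizes tailGraph ![a, p] ![S, T] (S ∪ T) := by
  refine .of_inter ?_ inj (by decide) ?_ ?_
  · simp [Fin.forall_fin_succ, tailGraph, hS, hT]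
  · simp [-Prod.forall, Fin.forall_fin_succ, tailGraph]
    grind
  · ext; simp [Fin.exists_fin_succ]

theorem Realizes.crossedCircle (hS : IsEdge S a a) (hT : IsEdge T a p) (hU : IsEdge U a q)
    (inj : Function.Injective ![a, p, q]) (hST : ∀ x ∈ S, x ∈ T → x = a)
    (hSU : ∀ x ∈ S, x ∈ U → x = a) (hTU : ∀ x ∈ T, x ∈ U → x = a) :
    Realizes crossedCircleGraph ![a, p, q] ![S, T, U] (S ∪ T ∪ U) := by
  refine .of_inter ?_ inj (by decide) ?_ ?_
  · simp [Fin.forall_fin_succ, crossedCircleGraph, hS, hT, hU]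
  · simp [-Prod.forall, Fin.forall_fin_succ, crossedCircleGraph]
    and_intros <;> grind
  · ext; simp [Fin.exists_fin_succ, or_assoc]

end

/-! ### Realizations of the letters -/

/-- Meant for Q: `y = 2` is the height at which the right arc is cut, and the other two alternatives
are the line of the tail as seen from its two halves. This line passes through the centre, so it
meets the circle at `x = 10 ± 6`, as the line `y = 2` does. -/
theorem eq_or_eq_of_circle {x y : ℝ} (h : (x - 10) ^ 2 + (y - 10) ^ 2 = 100)
    (h' : y = 2 ∨ (y - 6) * 3 = -((x - 13) * 4) ∨ (y - 2) * 3 = -((x - 16) * 4)) :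
    x = 4 ∨ x = 16 := by
  have : (x - 4) * (x - 16) = 0 := by
    rcases h' with h' | h'
    · rw [h'] at h
      linarith
    · have hy : y = (70 - 4 * x) / 3 := by rcases h' with h' | h' <;> linarith
      rw [hy] at h
      linarith
  rcases mul_eq_zero.1 this with h | h
  · exact Or.inl (by linarith)
  · exact Or.inr (by linarith)

/-- The strokes are cut at the branch point `(0, 10)` and regrouped into three arms that leave it.
The other `shape_` lemmas of this part cut their letters at the branch points in the same way. -/
theorem shape_E : Letter.shape .E =
    (seg 0 10 0 20 ∪ seg 0 20 12 20) ∪ seg 0 10 11 10 ∪ (seg 0 10 0 0 ∪ seg 0 0 12 0) := by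
  rw [Letter.shape]
  ext ⟨x, y⟩
  norm_num [mem_arcY, mem_seg_of_lt, mem_seg_of_gt, mem_seg_vertical, mem_seg_vertical']
  grind

theorem exists_realizes_E : ∃ pos S, Realizes tripodGraph pos S (Letter.shape .E) := by
  rw [shape_E]
  refine ⟨_, _, .tripod ((isEdge_seg ?_).trans (isEdge_seg ?_) ?_ ?_ ?_)
    (isEdge_seg ?_)
    ((isEdge_seg ?_).trans (isEdge_seg ?_) ?_ ?_ ?_) ?_ ?_ ?_ ?_⟩
  any_goals norm_num [Function.Injective, Fin.forall_fin_succ,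
    mem_arcY, mem_seg_of_lt, mem_seg_of_gt, mem_seg_vertical, mem_seg_vertical']
  all_goals grind

theorem shape_F : Letter.shape .F =
    (seg 0 10 0 20 ∪ seg 0 20 12 20) ∪ seg 0 10 11 10 ∪ seg 0 10 0 0 := by
  rw [Letter.shape]
  ext ⟨x, y⟩
  norm_num [mem_arcY, mem_seg_of_lt, mem_seg_of_gt, mem_seg_vertical, mem_seg_vertical']
  grind

theorem exists_realizes_F : ∃ pos S, Realizes tripodGraph pos S (Letter.shape .F) := by
  rw [shape_F]
  refine ⟨_, _, .tripod ((isEdge_seg ?_).trans (isEdge_seg ?_) ?_ ?_ ?_)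
    (isEdge_seg ?_)
    (isEdge_seg ?_) ?_ ?_ ?_ ?_⟩
  any_goals norm_num [Function.Injective, Fin.forall_fin_succ,
    mem_arcY, mem_seg_of_lt, mem_seg_of_gt, mem_seg_vertical, mem_seg_vertical']
  all_goals grind

/-- The arc ends at `(16, 2)`, inside the vertical stem, which makes this point the branch point. -/
theorem shape_G : Letter.shape .G =
    (arcY 1 10 10 10 0 2 ∪ arcY (-1) 10 10 10 0 20 ∪ arcY 1 10 10 10 18 20) ∪ seg 16 2 16 0 ∪
        (seg 16 2 16 8 ∪ seg 16 8 11 8) := by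
  rw [Letter.shape, circ_inter_fst_le_sixteen]
  ext ⟨x, y⟩
  norm_num [mem_arcY, mem_seg_of_lt, mem_seg_of_gt, mem_seg_vertical, mem_seg_vertical']
  grind

theorem exists_realizes_G : ∃ pos S, Realizes tripodGraph pos S (Letter.shape .G) := by
  rw [shape_G]
  refine ⟨_, _, .tripod (p := ((16, 18) : Plane)) (((isEdge_arcY ?_ ?_ ?_ ?_ ?_ ?_).symm.trans
      (b := ((10, 0) : Plane)) (isEdge_arcY ?_ ?_ ?_ ?_ ?_ ?_) ?_ ?_ ?_).trans (b :=
      ((10, 20) : Plane)) (isEdge_arcY ?_ ?_ ?_ ?_ ?_ ?_).symm ?_ ?_ ?_)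
    (isEdge_seg ?_)
    ((isEdge_seg ?_).trans (isEdge_seg ?_) ?_ ?_ ?_) ?_ ?_ ?_ ?_⟩
  any_goals norm_num [Function.Injective, Fin.forall_fin_succ,
    mem_arcY, mem_seg_of_lt, mem_seg_of_gt, mem_seg_vertical, mem_seg_vertical']
  all_goals grind [eq_or_eq_of_sq]

theorem shape_T : Letter.shape .T =
    seg 8 20 0 20 ∪ seg 8 20 16 20 ∪ seg 8 20 8 0 := by
  rw [Letter.shape]
  ext ⟨x, y⟩
  norm_num [mem_arcY, mem_seg_of_lt, mem_seg_of_gt, mem_seg_vertical, mem_seg_vertical']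
  grind

theorem exists_realizes_T : ∃ pos S, Realizes tripodGraph pos S (Letter.shape .T) := by
  rw [shape_T]
  refine ⟨_, _, .tripod (isEdge_seg ?_)
    (isEdge_seg ?_)
    (isEdge_seg ?_) ?_ ?_ ?_ ?_⟩
  any_goals norm_num [Function.Injective, Fin.forall_fin_succ,
    mem_arcY, mem_seg_of_lt, mem_seg_of_gt, mem_seg_vertical, mem_seg_vertical']
  all_goals grind

theorem shape_Y : Letter.shape .Y =
    seg 8 8 0 20 ∪ seg 8 8 16 20 ∪ seg 8 8 8 0 := by
  rw [Letter.shape]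
  ext ⟨x, y⟩
  norm_num [mem_arcY, mem_seg_of_lt, mem_seg_of_gt, mem_seg_vertical, mem_seg_vertical']

theorem exists_realizes_Y : ∃ pos S, Realizes tripodGraph pos S (Letter.shape .Y) := by
  rw [shape_Y]
  refine ⟨_, _, .tripod (isEdge_seg ?_)
    (isEdge_seg ?_)
    (isEdge_seg ?_) ?_ ?_ ?_ ?_⟩
  any_goals norm_num [Function.Injective, Fin.forall_fin_succ,
    mem_arcY, mem_seg_of_lt, mem_seg_of_gt, mem_seg_vertical, mem_seg_vertical']
  all_goals grind

theorem shape_X : Letter.shape .X =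
    seg 8 10 0 0 ∪ seg 8 10 16 20 ∪ seg 8 10 0 20 ∪ seg 8 10 16 0 := by
  rw [Letter.shape]
  ext ⟨x, y⟩
  norm_num [mem_arcY, mem_seg_of_lt, mem_seg_of_gt, mem_seg_vertical, mem_seg_vertical']
  grind

theorem exists_realizes_X : ∃ pos S, Realizes crossGraph pos S (Letter.shape .X) := by
  rw [shape_X]
  refine ⟨_, _, .cross (isEdge_seg ?_)
    (isEdge_seg ?_)
    (isEdge_seg ?_)
    (isEdge_seg ?_) ?_ ?_ ?_ ?_ ?_ ?_ ?_⟩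
  any_goals norm_num [Function.Injective, Fin.forall_fin_succ,
    mem_arcY, mem_seg_of_lt, mem_seg_of_gt, mem_seg_vertical, mem_seg_vertical']
  all_goals grind

theorem shape_H : Letter.shape .H =
    seg 0 10 14 10 ∪ seg 0 10 0 20 ∪ seg 0 10 0 0 ∪ seg 14 10 14 20 ∪ seg 14 10 14 0 := by
  rw [Letter.shape]
  ext ⟨x, y⟩
  norm_num [mem_arcY, mem_seg_of_lt, mem_seg_of_gt, mem_seg_vertical, mem_seg_vertical']
  grind

theorem exists_realizes_H : ∃ pos S, Realizes doubleTripodGraph pos S (Letter.shape .H) := by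
  rw [shape_H]
  refine ⟨_, _, .doubleTripod (isEdge_seg ?_)
    (isEdge_seg ?_)
    (isEdge_seg ?_)
    (isEdge_seg ?_)
    (isEdge_seg ?_) ?_ ?_ ?_ ?_ ?_ ?_ ?_ ?_ ?_ ?_ ?_⟩
  any_goals norm_num [Function.Injective, Fin.forall_fin_succ,
    mem_arcY, mem_seg_of_lt, mem_seg_of_gt, mem_seg_vertical, mem_seg_vertical']
  all_goals grind

theorem shape_K : Letter.shape .K =
    seg 0 7 4 11 ∪ seg 0 7 0 0 ∪ seg 0 7 0 20 ∪ seg 4 11 13 20 ∪ seg 4 11 15 0 := by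
  rw [Letter.shape]
  ext ⟨x, y⟩
  norm_num [mem_arcY, mem_seg_of_lt, mem_seg_of_gt, mem_seg_vertical, mem_seg_vertical']
  grind

theorem exists_realizes_K : ∃ pos S, Realizes doubleTripodGraph pos S (Letter.shape .K) := by
  rw [shape_K]
  refine ⟨_, _, .doubleTripod (isEdge_seg ?_)
    (isEdge_seg ?_)
    (isEdge_seg ?_)
    (isEdge_seg ?_)
    (isEdge_seg ?_) ?_ ?_ ?_ ?_ ?_ ?_ ?_ ?_ ?_ ?_ ?_⟩
  any_goals norm_num [Function.Injective, Fin.forall_fin_succ,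
    mem_arcY, mem_seg_of_lt, mem_seg_of_gt, mem_seg_vertical, mem_seg_vertical']
  all_goals grind

/-- The crossbar and the path over the apex form the cycle through the branch points `(2, 5)` and
`(14, 5)`; the feet of the legs are the tails. -/
theorem shape_A : Letter.shape .A =
    seg 2 5 14 5 ∪ (seg 2 5 8 20 ∪ seg 8 20 14 5) ∪ seg 2 5 0 0 ∪ seg 14 5 16 0 := by
  rw [Letter.shape]
  ext ⟨x, y⟩
  norm_num [mem_arcY, mem_seg_of_lt, mem_seg_of_gt, mem_seg_vertical, mem_seg_vertical']
  grind (splits := 30)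

theorem exists_realizes_A : ∃ pos S, Realizes twoTailGraph pos S (Letter.shape .A) := by
  rw [shape_A]
  refine ⟨_, _, .twoTail (isEdge_seg ?_)
    ((isEdge_seg ?_).trans (isEdge_seg ?_) ?_ ?_ ?_)
    (isEdge_seg ?_)
    (isEdge_seg ?_) ?_ ?_ ?_ ?_ ?_ ?_ ?_⟩
  any_goals norm_num [Function.Injective, Fin.forall_fin_succ,
    mem_arcY, mem_seg_of_lt, mem_seg_of_gt, mem_seg_vertical, mem_seg_vertical']
  all_goals grind

/-- The leg starts at `(6, 10)`, before the lower bar ends at `(7, 10)`, so the remainder of the bar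
belongs to the long way round the bowl. -/
theorem shape_R : Letter.shape .R =
    seg 0 10 6 10 ∪ (seg 0 10 0 20 ∪ seg 0 20 7 20 ∪ arcY 1 7 15 5 10 20 ∪ seg 7 10 6 10) ∪
        seg 0 10 0 0 ∪ seg 6 10 12 0 := by
  rw [Letter.shape, circ_inter_le_fst (c := 10) (d := 20) (by norm_num) (by norm_num) (by norm_num)]
  ext ⟨x, y⟩
  norm_num [mem_arcY, mem_seg_of_lt, mem_seg_of_gt, mem_seg_vertical, mem_seg_vertical']
  grind (splits := 30)

theorem exists_realizes_R : ∃ pos S, Realizes twoTailGraph pos S (Letter.shape .R) := by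
  rw [shape_R]
  refine ⟨_, _, .twoTail (isEdge_seg ?_)
    ((((isEdge_seg ?_).trans (isEdge_seg ?_) ?_ ?_ ?_).trans (isEdge_arcY ?_ ?_ ?_ ?_ ?_ ?_).symm
        ?_ ?_ ?_).trans (isEdge_seg ?_) ?_ ?_ ?_)
    (isEdge_seg ?_)
    (isEdge_seg ?_) ?_ ?_ ?_ ?_ ?_ ?_ ?_⟩
  any_goals norm_num [Function.Injective, Fin.forall_fin_succ,
    mem_arcY, mem_seg_of_lt, mem_seg_of_gt, mem_seg_vertical, mem_seg_vertical']
  all_goals grind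

theorem shape_P : Letter.shape .P =
    (seg 0 10 0 20 ∪ seg 0 20 7 20 ∪ arcY 1 7 15 5 10 20 ∪ seg 7 10 0 10) ∪ seg 0 10 0 0 := by
  rw [Letter.shape, circ_inter_le_fst (c := 10) (d := 20) (by norm_num) (by norm_num) (by norm_num)]
  ext ⟨x, y⟩
  norm_num [mem_arcY, mem_seg_of_lt, mem_seg_of_gt, mem_seg_vertical, mem_seg_vertical']
  grind

theorem exists_realizes_P : ∃ pos S, Realizes tailGraph pos S (Letter.shape .P) := by
  rw [shape_P]
  refine ⟨_, _, .tail ((((isEdge_seg ?_).trans (isEdge_seg ?_) ?_ ?_ ?_).trans (isEdge_arcY ?_ ?_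
      ?_ ?_ ?_ ?_).symm ?_ ?_ ?_).trans (isEdge_seg ?_) ?_ ?_ ?_)
    (isEdge_seg ?_) ?_ ?_⟩
  any_goals norm_num [Function.Injective, Fin.forall_fin_succ,
    mem_arcY, mem_seg_of_lt, mem_seg_of_gt, mem_seg_vertical, mem_seg_vertical']
  all_goals grind

theorem shape_Q : Letter.shape .Q =
    (arcY 1 10 10 10 2 20 ∪ arcY (-1) 10 10 10 0 20 ∪ arcY 1 10 10 10 0 2) ∪ seg 16 2 13 6 ∪
        seg 16 2 19 (-2) := by
  rw [Letter.shape, circ_eq_union (c := 0) (d := 20) (by norm_num) (by norm_num) (by norm_num),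
      ← arcY_union (d := 2) (by norm_num) (by norm_num)]
  ext ⟨x, y⟩
  norm_num [mem_arcY, mem_seg_of_lt, mem_seg_of_gt, mem_seg_vertical, mem_seg_vertical']
  grind

theorem exists_realizes_Q : ∃ pos S, Realizes crossedCircleGraph pos S (Letter.shape .Q) := by
  rw [shape_Q]
  refine ⟨_, _, .crossedCircle (((isEdge_arcY ?_ ?_ ?_ ?_ ?_ ?_).trans (b := ((10, 20) : Plane))
      (isEdge_arcY ?_ ?_ ?_ ?_ ?_ ?_).symm ?_ ?_ ?_).trans (b := ((10, 0) : Plane)) (isEdge_arcY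
      ?_ ?_ ?_ ?_ ?_ ?_) ?_ ?_ ?_)
    (isEdge_seg ?_)
    (isEdge_seg ?_) ?_ ?_ ?_ ?_⟩
  any_goals norm_num [Function.Injective, Fin.forall_fin_succ,
    mem_arcY, mem_seg_of_lt, mem_seg_of_gt, mem_seg_vertical, mem_seg_vertical']
  all_goals grind [eq_or_eq_of_sq, eq_or_eq_of_circle]

/-- The branch points are `(0, 10)` and `(8, 10)`, where the two bowls touch. -/
theorem shape_B : Letter.shape .B =
    seg 0 10 8 10 ∪ (seg 0 10 0 20 ∪ seg 0 20 8 20 ∪ arcY 1 8 15 5 10 20) ∪ (seg 0 10 0 0 ∪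
        seg 0 0 8 0 ∪ arcY 1 8 5 5 0 10) := by
  rw [Letter.shape, circ_inter_le_fst (c := 10) (d := 20) (by norm_num) (by norm_num)
      (by norm_num), circ_inter_le_fst (c := 0) (d := 10) (by norm_num) (by norm_num) (by norm_num)]
  ext ⟨x, y⟩
  norm_num [mem_arcY, mem_seg_of_lt, mem_seg_of_gt, mem_seg_vertical, mem_seg_vertical']
  grind (splits := 30)

theorem exists_realizes_B : ∃ pos S, Realizes thetaGraph pos S (Letter.shape .B) := by
  rw [shape_B]
  refine ⟨_, _, .theta (isEdge_seg ?_)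
    (((isEdge_seg ?_).trans (isEdge_seg ?_) ?_ ?_ ?_).trans (isEdge_arcY ?_ ?_ ?_ ?_ ?_ ?_).symm
        ?_ ?_ ?_)
    (((isEdge_seg ?_).trans (isEdge_seg ?_) ?_ ?_ ?_).trans (isEdge_arcY ?_ ?_ ?_ ?_ ?_ ?_) ?_ ?_
        ?_) ?_ ?_ ?_ ?_⟩
  any_goals norm_num [Function.Injective, Fin.forall_fin_succ,
    mem_arcY, mem_seg_of_lt, mem_seg_of_gt, mem_seg_vertical, mem_seg_vertical']
  all_goals grind

/-! ### Topological invariance -/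

section
variable {X Y : Set Plane}

theorem Homeomorphic.numPathComponents_eq (h : Homeomorphic X Y) :
    numPathComponents X = numPathComponents Y := by
  obtain ⟨h⟩ := h
  refine ENat.card_congr (Quotient.congr h.toEquiv fun x y => ⟨?_, ?_⟩)
  · rintro ⟨p⟩
    exact ⟨p.map h.continuous⟩
  · rintro ⟨p⟩
    have : Joined (h.symm (h x)) (h.symm (h y)) := ⟨p.map h.symm.continuous⟩
    rwa [h.symm_apply_apply, h.symm_apply_apply] at this

theorem homeomorphic_diff_singleton (h : X ≃ₜ Y) (p : X) :
    Homeomorphic (X \ {p.1}) (Y \ {(h p).1}) := by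
  have h₁ : ∀ x : ↥(X \ {p.1}), (h ⟨x, x.2.1⟩).1 ∈ Y \ {(h p).1} := fun x =>
    ⟨(h _).2, fun e => x.2.2 (congrArg Subtype.val (h.injective (Subtype.ext e)))⟩
  have h₂ : ∀ y : ↥(Y \ {(h p).1}), (h.symm ⟨y, y.2.1⟩).1 ∈ X \ {p.1} := fun y =>
    ⟨(h.symm _).2, fun e => y.2.2 (congrArg Subtype.val (h.symm_apply_eq.1 (Subtype.ext e)))⟩
  exact ⟨{
    toFun := fun x => ⟨_, h₁ x⟩
    invFun := fun y => ⟨_, h₂ y⟩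
    left_inv := fun x => by simp
    right_inv := fun y => by simp
    continuous_toFun := by fun_prop
    continuous_invFun := by fun_prop }⟩

theorem intersectionOrder_homeomorph (h : X ≃ₜ Y) (p : X) :
    intersectionOrder Y (h p) = intersectionOrder X p :=
  (homeomorphic_diff_singleton h p).numPathComponents_eq.symm

theorem Homeomorphic.orderCount_eq (h : Homeomorphic X Y) (n : ℕ) :
    orderCount n X = orderCount n Y := by
  obtain ⟨h⟩ := h
  -- The points are counted in the subtype, where the homeomorphism acts.
  have key : ∀ Z : Set Plane,
      orderCount n Z = {x : Z | intersectionOrder Z x = n}.encard := fun Z => by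
    rw [orderCount, ← Subtype.val_injective.encard_image]
    congr 1
    ext p
    simp [and_comm]
  rw [key, key, ← h.injective.encard_image]
  congr 1
  ext y
  obtain ⟨x, rfl⟩ := h.surjective y
  rw [h.injective.mem_set_image, mem_ofPred_eq, mem_ofPred_eq, intersectionOrder_homeomorph]

end

/-! ### Removal of two points -/

section
variable {n m : ℕ} {G : Graph n m} {pos : Fin m → Plane} {S : Fin n → Set Plane} {X Y : Set Plane}

/-- A point that is different from the vertex `v` has an order in `K` after the removal of `v`. -/
structure Graph.OrdersWithout (G : Graph n m) (v : Fin m) (K : List ℕ) : Prop where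
  vert : ∀ w, w ≠ v → ∃ k ∈ K, G.HasComponents {v, w} k
  -- In the subdivision `v.succ` is the old vertex `v`, and `0` is the removed point of `e`.
  edge : ∀ e, ∃ k ∈ K, (G.subdiv e).HasComponents {v.succ, 0} k

theorem Realizes.order_without (h : Realizes G pos S X) {v : Fin m} {K : List ℕ}
    (hG : G.OrdersWithout v K) {z : Plane} (hz : z ∈ X \ {pos v}) :
    ∃ k ∈ K, intersectionOrder (X \ {pos v}) z = k := by
  by_cases hw : ∃ w, z = pos w
  · obtain ⟨w, rfl⟩ := hw
    obtain ⟨k, hk, hk'⟩ := hG.vert w fun e => hz.2 (e ▸ rfl)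
    exact ⟨k, hk, h.order_vertex_diff hk'⟩
  · push Not at hw
    obtain ⟨e, he⟩ := h.exists_edge hz.1
    obtain ⟨S', h'⟩ := h.subdiv he hw
    obtain ⟨k, hk, hk'⟩ := hG.edge e
    exact ⟨k, hk, by simpa using h'.order_vertex_diff hk'⟩

theorem circleGraph_ordersWithout : circleGraph.OrdersWithout 0 [2] := ⟨by decide, by decide⟩

/-- The vertex `0` of the subdivision is the first removed point when that point is not the base
point. -/
theorem circleGraph_subdiv_ordersWithout (e : Fin 1) :
    (circleGraph.subdiv e).OrdersWithout 0 [2] := by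
  rw [Subsingleton.elim e 0]
  exact ⟨by decide, by decide⟩

theorem tailGraph_ordersWithout : tailGraph.OrdersWithout 0 [2, 3] := ⟨by decide, by decide⟩

/-- Only the tail, edge `1`, has to be subdivided: the interior points of the loop have order 1. -/
theorem tailGraph_subdiv_ordersWithout : (tailGraph.subdiv 1).OrdersWithout 0 [2, 3] :=
  ⟨by decide, by decide +kernel⟩

/-- The two branch points are removed, and the three open arcs remain. -/
theorem Realizes.order_theta {pos : Fin 2 → Plane} {S : Fin 3 → Set Plane}
    (h : Realizes thetaGraph pos S X) :
    ∃ p ∈ X, ∃ q ∈ X \ {p}, intersectionOrder (X \ {p}) q = 3 :=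
  ⟨pos 0, h.pos_mem 0, pos 1, ⟨h.pos_mem 1, fun e => absurd (h.inj e) (by decide)⟩,
    h.order_vertex_diff (k := 3) (by decide)⟩

theorem Realizes.order_circle {pos : Fin 1 → Plane} {S : Fin 1 → Set Plane}
    (h : Realizes circleGraph pos S X) :
    ∀ p ∈ X, ∀ q ∈ X \ {p}, intersectionOrder (X \ {p}) q = 2 := by
  intro p hp q hq
  by_cases hv : ∃ v, p = pos v
  · obtain ⟨v, rfl⟩ := hv
    rw [Subsingleton.elim v 0] at hq ⊢
    obtain ⟨k, hk, hk'⟩ := h.order_without circleGraph_ordersWithout hq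
    rw [hk', List.mem_singleton.1 hk]
    rfl
  · push Not at hv
    obtain ⟨e, he⟩ := h.exists_edge hp
    obtain ⟨S', h'⟩ := h.subdiv he hv
    obtain ⟨k, hk, hk'⟩ := h'.order_without (circleGraph_subdiv_ordersWithout e) hq
    exact hk'.trans (by rw [List.mem_singleton.1 hk]; rfl)

/-- The two branch points are removed, which leaves two open arcs of the cycle and two tails. -/
theorem Realizes.order_twoTail {pos : Fin 4 → Plane} {S : Fin 4 → Set Plane}
    (h : Realizes twoTailGraph pos S X) :
    ∃ p ∈ X, intersectionOrder X p = 2 ∧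
      ∃ z ∈ X \ {p}, intersectionOrder (X \ {p}) z = 4 :=
  ⟨pos 0, h.pos_mem 0, h.order_vertex (twoTailGraph_orders.vert 0), pos 1,
    ⟨h.pos_mem 1, fun e => absurd (h.inj e) (by decide)⟩,
    h.order_vertex_diff (k := 4) (by decide +kernel)⟩

theorem Realizes.order_tail {pos : Fin 2 → Plane} {S : Fin 2 → Set Plane}
    (h : Realizes tailGraph pos S X) :
    ∀ p ∈ X, intersectionOrder X p = 2 → ∀ z ∈ X \ {p},
      intersectionOrder (X \ {p}) z = 2 ∨ intersectionOrder (X \ {p}) z = 3 := by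
  intro p hp hp2 z hz
  have key : ∃ k ∈ [2, 3], intersectionOrder (X \ {p}) z = (k : ℕ) := by
    by_cases hv : ∃ v, p = pos v
    · obtain ⟨v, rfl⟩ := hv
      have hv := (h.order_vertex (tailGraph_orders.vert v)).symm.trans hp2
      fin_cases v
      · exact h.order_without tailGraph_ordersWithout hz
      -- The free end of the tail has order 1, not 2.
      · norm_num at hv
    · push Not at hv
      obtain ⟨e, he⟩ := h.exists_edge hp
      obtain ⟨S', h'⟩ := h.subdiv he hv
      have ho := (h.order_edge (tailGraph_orders.edge e) he hv).symm.trans hp2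
      fin_cases e
      · norm_num at ho
      · exact h'.order_without tailGraph_subdiv_ordersWithout hz
  simpa using key

theorem not_homeomorphic_theta_circle {pos : Fin 2 → Plane} {S : Fin 3 → Set Plane}
    {pos' : Fin 1 → Plane} {S' : Fin 1 → Set Plane} (h : Realizes thetaGraph pos S X)
    (h' : Realizes circleGraph pos' S' Y) : ¬ Homeomorphic X Y := by
  rintro ⟨f⟩
  obtain ⟨p, hp, q, hq, h3⟩ := h.order_theta
  obtain ⟨g⟩ := homeomorphic_diff_singleton f ⟨p, hp⟩
  have h4 := h'.order_circle _ (f ⟨p, hp⟩).2 _ (g ⟨q, hq⟩).2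
  rw [intersectionOrder_homeomorph, h3] at h4
  norm_num at h4

theorem not_homeomorphic_twoTail_tail {pos : Fin 4 → Plane} {S : Fin 4 → Set Plane}
    {pos' : Fin 2 → Plane} {S' : Fin 2 → Set Plane} (h : Realizes twoTailGraph pos S X)
    (h' : Realizes tailGraph pos' S' Y) : ¬ Homeomorphic X Y := by
  rintro ⟨f⟩
  obtain ⟨p, hp, hp2, z, hz, h3⟩ := h.order_twoTail
  obtain ⟨g⟩ := homeomorphic_diff_singleton f ⟨p, hp⟩
  have h4 := h'.order_tail _ (f ⟨p, hp⟩).2 (by rw [intersectionOrder_homeomorph, hp2]) _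
    (g ⟨z, hz⟩).2
  rw [intersectionOrder_homeomorph, h3] at h4
  norm_num at h4

/-! ### Classification -/

/-- The nine homeomorphism types of letters. -/
def Letter.kind : Letter → Fin 9
  | .A | .R => 0
  | .B => 1
  | .C | .I | .J | .L | .M | .N | .S | .U | .V | .W | .Z => 2
  | .D | .O => 3
  | .E | .F | .G | .T | .Y => 4
  | .H | .K => 5
  | .P => 6
  | .Q => 7
  | .X => 8

/-- The multigraph that is realized by the letters of a given type. -/
def kindGraph : Fin 9 → Σ n m, Graph n m :=
  ![⟨4, 4, twoTailGraph⟩, ⟨3, 2, thetaGraph⟩, ⟨1, 2, arcGraph⟩, ⟨1, 1, circleGraph⟩,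
    ⟨3, 4, tripodGraph⟩, ⟨5, 6, doubleTripodGraph⟩, ⟨2, 2, tailGraph⟩, ⟨3, 3, crossedCircleGraph⟩,
    ⟨4, 5, crossGraph⟩]

/-- The orders of infinitely many points, and the orders of the other points. -/
def kindProfile : Fin 9 → List ℕ × List ℕ :=
  ![([1, 2], []), ([1], []), ([2], [1, 1]), ([1], []), ([2], [3, 1, 1, 1]),
    ([2], [3, 3, 1, 1, 1, 1]), ([1, 2], []), ([1, 2], [3]), ([2], [4, 1, 1, 1, 1])]

theorem exists_realizes (a : Letter) :
    ∃ pos S, Realizes (kindGraph a.kind).2.2 pos S a.shape := by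
  cases a
  case A => exact exists_realizes_A
  case B => exact exists_realizes_B
  case C => exact ⟨_, _, .of_isEdge isEdge_C (by norm_num)⟩
  case D => exact ⟨_, _, .of_loop isEdge_D⟩
  case E => exact exists_realizes_E
  case F => exact exists_realizes_F
  case G => exact exists_realizes_G
  case H => exact exists_realizes_H
  case I => exact ⟨_, _, .of_isEdge isEdge_I (by norm_num)⟩
  case J => exact ⟨_, _, .of_isEdge isEdge_J (by norm_num)⟩
  case K => exact exists_realizes_K
  case L => exact ⟨_, _, .of_isEdge isEdge_L (by norm_num)⟩
  case M => exact ⟨_, _, .of_isEdge isEdge_M (by norm_num)⟩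
  case N => exact ⟨_, _, .of_isEdge isEdge_N (by norm_num)⟩
  case O => exact ⟨_, _, .of_loop isEdge_O⟩
  case P => exact exists_realizes_P
  case Q => exact exists_realizes_Q
  case R => exact exists_realizes_R
  case S => exact ⟨_, _, .of_isEdge isEdge_S (by norm_num)⟩
  case T => exact exists_realizes_T
  case U => exact ⟨_, _, .of_isEdge isEdge_U (by norm_num)⟩
  case V => exact ⟨_, _, .of_isEdge isEdge_V (by norm_num)⟩
  case W => exact ⟨_, _, .of_isEdge isEdge_W (by norm_num)⟩
  case X => exact exists_realizes_X
  case Y => exact exists_realizes_Y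
  case Z => exact ⟨_, _, .of_isEdge isEdge_Z (by norm_num)⟩

/-- The number of points of order `n`, where `none` stands for infinity. -/
def profileCount (l : List ℕ × List ℕ) (n : ℕ) : Option ℕ :=
  if n ∈ l.1 then none else some (l.2.count n)

theorem Realizes.orderCount_eq_profileCount (h : Realizes G pos S X) {a : Fin n → ℕ}
    {b : Fin m → ℕ} (hG : G.Orders a b) {l : List ℕ × List ℕ} (h₁ : (List.ofFn a).dedup = l.1)
    (h₂ : (List.ofFn b).filter (· ∉ l.1) = l.2) (k : ℕ) :
    orderCount k X = (profileCount l k).elim ⊤ (↑) := by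
  have hmem : k ∈ List.ofFn a ↔ k ∈ l.1 := by rw [← h₁, List.mem_dedup]
  simp only [h.orderCount_eq hG, profileCount, hmem]
  split_ifs with hk
  · rfl
  · rw [← h₂, Option.elim_some, List.count_filter (by simpa using hk)]

theorem orderCount_shape (a : Letter) (k : ℕ) :
    orderCount k a.shape = (profileCount (kindProfile a.kind) k).elim ⊤ (↑) := by
  obtain ⟨pos, S, h⟩ := exists_realizes a
  generalize a.kind = i at *
  fin_cases i
  · exact h.orderCount_eq_profileCount twoTailGraph_orders (by decide) (by decide) k
  · exact h.orderCount_eq_profileCount thetaGraph_orders (by decide) (by decide) k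
  · exact h.orderCount_eq_profileCount arcGraph_orders (by decide) (by decide) k
  · exact h.orderCount_eq_profileCount circleGraph_orders (by decide) (by decide) k
  · exact h.orderCount_eq_profileCount tripodGraph_orders (by decide) (by decide) k
  · exact h.orderCount_eq_profileCount doubleTripodGraph_orders (by decide) (by decide) k
  · exact h.orderCount_eq_profileCount tailGraph_orders (by decide) (by decide) k
  · exact h.orderCount_eq_profileCount crossedCircleGraph_orders (by decide) (by decide) k
  · exact h.orderCount_eq_profileCount crossGraph_orders (by decide) (by decide) k

theorem elim_top_injective :
    Function.Injective fun o : Option ℕ => (o.elim ⊤ (↑) : ℕ∞) := by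
  rintro (_ | i) (_ | j) h <;> simp_all

theorem orderCount_eq_iff (a b : Letter) :
    (∀ n, orderCount n a.shape = orderCount n b.shape) ↔
      kindProfile a.kind = kindProfile b.kind := by
  constructor
  · intro h
    -- No order exceeds 4, so `n < 5` suffices, and the bound makes the search decidable.
    have key : ∀ i j : Fin 9, kindProfile i ≠ kindProfile j → ∃ n < 5,
        profileCount (kindProfile i) n ≠ profileCount (kindProfile j) n := by decide
    by_contra hne
    obtain ⟨n, -, hn⟩ := key _ _ hne
    refine hn (elim_top_injective ?_)
    have := h n
    rwa [orderCount_shape, orderCount_shape] at this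
  · intro h n
    rw [orderCount_shape, orderCount_shape, h]

theorem kindProfile_eq_iff (i j : Fin 9) : kindProfile i = kindProfile j ↔
    i = j ∨ (i = 0 ∨ i = 6) ∧ (j = 0 ∨ j = 6) ∨ (i = 1 ∨ i = 3) ∧ (j = 1 ∨ j = 3) := by
  revert i j
  decide

/-- The counts leave only the pairs of types 0, 6 and 1, 3 undecided, which the removal of two
points separates. Conversely, letters of one type realize the same multigraph. -/
theorem homeomorphic_iff (a b : Letter) : Homeomorphic a.shape b.shape ↔ a.kind = b.kind := by
  obtain ⟨pos, S, ha⟩ := exists_realizes a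
  obtain ⟨pos', S', hb⟩ := exists_realizes b
  constructor
  · intro h
    have hp := (kindProfile_eq_iff _ _).1 ((orderCount_eq_iff a b).1 h.orderCount_eq)
    have h' : Homeomorphic b.shape a.shape := h.map Homeomorph.symm
    generalize a.kind = i at *
    generalize b.kind = j at *
    rcases hp with hp | ⟨rfl | rfl, rfl | rfl⟩ | ⟨rfl | rfl, rfl | rfl⟩
    · exact hp
    · rfl
    · exact absurd h (not_homeomorphic_twoTail_tail ha hb)
    · exact absurd h' (not_homeomorphic_twoTail_tail hb ha)
    · rfl
    · rfl
    · exact absurd h (not_homeomorphic_theta_circle ha hb)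
    · exact absurd h' (not_homeomorphic_theta_circle hb ha)
    · rfl
  · intro h
    generalize a.kind = i at *
    subst h
    exact ha.homeomorphic hb

theorem kind_surjective : Function.Surjective Letter.kind := by
  intro i
  fin_cases i
  exacts [⟨.A, rfl⟩, ⟨.B, rfl⟩, ⟨.C, rfl⟩, ⟨.D, rfl⟩, ⟨.E, rfl⟩, ⟨.H, rfl⟩, ⟨.P, rfl⟩, ⟨.Q, rfl⟩,
    ⟨.X, rfl⟩]

theorem classes_eq_range :
    homeomorphismSetoid.classes = Set.range fun i : Fin 9 => {a : Letter | a.kind = i} := by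
  have hr : ∀ b, {a : Letter | homeomorphismSetoid a b} = {a : Letter | a.kind = b.kind} :=
    fun b => Set.ext fun a => homeomorphic_iff a b
  ext s
  constructor
  · rintro ⟨b, rfl⟩
    exact ⟨b.kind, (hr b).symm⟩
  · rintro ⟨i, rfl⟩
    obtain ⟨b, rfl⟩ := kind_surjective i
    exact ⟨b, (hr b).symm⟩

set_option maxHeartbeats 1000000 in
theorem classes_eq : homeomorphismSetoid.classes =
    ({{.A, .R}, {.B}, {.C, .I, .J, .L, .M, .N, .S, .U, .V, .W, .Z}, {.D, .O},
      {.E, .F, .G, .T, .Y}, {.H, .K}, {.P}, {.Q}, {.X}} : Set (Set Letter)) := by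
  have key : (fun i : Fin 9 => {a : Letter | a.kind = i}) =
      ![{.A, .R}, {.B}, {.C, .I, .J, .L, .M, .N, .S, .U, .V, .W, .Z}, {.D, .O},
        {.E, .F, .G, .T, .Y}, {.H, .K}, {.P}, {.Q}, {.X}] := by
    funext i
    ext a
    fin_cases i <;> cases a <;> simp [Letter.kind]
  rw [classes_eq_range, key]
  simp only [Matrix.range_cons, Matrix.range_empty, union_empty, singleton_union]

theorem ncard_classes : homeomorphismSetoid.classes.ncard = 9 := by
  have hinj : Function.Injective fun i : Fin 9 => {a : Letter | a.kind = i} := by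
    intro i j hij
    obtain ⟨b, rfl⟩ := kind_surjective i
    exact (Set.ext_iff.1 hij b).1 rfl
  rw [classes_eq_range, ← image_univ, Set.ncard_image_of_injective _ hinj, Set.ncard_univ,
    Nat.card_fin]

theorem mem_ARP_iff (c : Letter) :
    c ∈ ({.A, .R, .P} : Set Letter) ↔ c.kind = 0 ∨ c.kind = 6 := by
  cases c <;> simp [Letter.kind]

theorem mem_BDO_iff (c : Letter) :
    c ∈ ({.B, .D, .O} : Set Letter) ↔ c.kind = 1 ∨ c.kind = 3 := by
  cases c <;> simp [Letter.kind]

end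

end Alphabet

theorem mainTheorem1 :
    -- the homeomorphism classes of the letters are exactly the following nine
    (Alphabet.homeomorphismSetoid.classes =
        ({{.A, .R},
          {.B},
          {.C, .I, .J, .L, .M, .N, .S, .U, .V, .W, .Z},
          {.D, .O},
          {.E, .F, .G, .T, .Y},
          {.H, .K},
          {.P},
          {.Q},
          {.X}} : Set (Set Alphabet.Letter)) ∧
      Alphabet.homeomorphismSetoid.classes.ncard = 9) ∧
    -- the counts of points of each intersection order tell apart any two classes, except that
    -- they agree on A, R, P and on B, D, O
    (∀ a b : Alphabet.Letter,
      (∀ n : ℕ, Alphabet.orderCount n a.shape = Alphabet.orderCount n b.shape) ↔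
        (Alphabet.Homeomorphic a.shape b.shape ∨
          (a ∈ ({.A, .R, .P} : Set Alphabet.Letter) ∧
            b ∈ ({.A, .R, .P} : Set Alphabet.Letter)) ∨
          (a ∈ ({.B, .D, .O} : Set Alphabet.Letter) ∧
            b ∈ ({.B, .D, .O} : Set Alphabet.Letter)))) ∧
    -- B and O are told apart by the removal of two points
    ((∃ p ∈ Alphabet.Letter.B.shape, ∃ q ∈ Alphabet.Letter.B.shape \ {p},
        Alphabet.intersectionOrder (Alphabet.Letter.B.shape \ {p}) q = 3) ∧
      (∀ p ∈ Alphabet.Letter.O.shape, ∀ q ∈ Alphabet.Letter.O.shape \ {p},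
        Alphabet.intersectionOrder (Alphabet.Letter.O.shape \ {p}) q = 2)) ∧
    -- A and P are told apart by the removal of two points, the first of order 2
    ((∃ p ∈ Alphabet.Letter.A.shape, Alphabet.intersectionOrder Alphabet.Letter.A.shape p = 2 ∧
        ∃ z ∈ Alphabet.Letter.A.shape \ {p},
          Alphabet.intersectionOrder (Alphabet.Letter.A.shape \ {p}) z = 4) ∧
      (∀ p ∈ Alphabet.Letter.P.shape, Alphabet.intersectionOrder Alphabet.Letter.P.shape p = 2 →
        ∀ z ∈ Alphabet.Letter.P.shape \ {p},
          Alphabet.intersectionOrder (Alphabet.Letter.P.shape \ {p}) z = 2 ∨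
          Alphabet.intersectionOrder (Alphabet.Letter.P.shape \ {p}) z = 3)) := by
  refine ⟨⟨Alphabet.classes_eq, Alphabet.ncard_classes⟩, fun a b => ?_, ⟨?_, ?_⟩, ⟨?_, ?_⟩⟩
  · rw [Alphabet.orderCount_eq_iff, Alphabet.homeomorphic_iff, Alphabet.kindProfile_eq_iff]
    rw [Alphabet.mem_ARP_iff, Alphabet.mem_ARP_iff, Alphabet.mem_BDO_iff, Alphabet.mem_BDO_iff]
  · obtain ⟨pos, S, h⟩ := Alphabet.exists_realizes_B
    exact h.order_theta
  · exact (Alphabet.Realizes.of_loop Alphabet.isEdge_O).order_circle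
  · obtain ⟨pos, S, h⟩ := Alphabet.exists_realizes_A
    exact h.order_twoTail
  · obtain ⟨pos, S, h⟩ := Alphabet.exists_realizes_P
    exact h.order_tail
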